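/- Let $p$ be an odd prime. Let $\omega$ be the Teichmüller character modulo $p$ with values in $\mathbb{C}_p$, put $\langle a\rangle=\omega(a)^{-1}a$ for integers $a$ prime to $p$, and $\langle a\rangle^{s}=\sum_{j\ge 0}\binom{s}{j}(\langle a\rangle-1)^j$. For a Dirichlet character $\chi$ with values in $\mathbb{C}_p$ let $L_p(s,\chi)$ be the Kubota–Leopoldt $p$-adic $L$-function: the function on $\{s\in\mathbb{C}_p : |s|<p^{(p-2)/(p-1)}\}$, analytic if $\chi\neq 1$ and analytic except for at most a simple pole at $s=1$ if $\chi=1$, such that $$L_p(1-n,\chi)=-\bigl(1-\chi\omega^{-n}(p)\,p^{n-1}\bigr)\frac{B_{n,\chi\omega^{-n}}}{n}\qquad(n\ge 1),$$ where $\chi\omega^{-n}$ denotes the primitive character and $B_{n,\psi}$ are the generalized Bernoulli numbers. (1) Let $\chi$ be an even primitive Dirichlet character of odd conductor $f$. Then for all $s\in\mathbb{C}_p$ with $|s|<p^{(p-2)/(p-1)}$, $$(1-\chi(2)\langle 2\rangle^{1-s})\,L_p(s,\chi)=\lim_{n\to\infty}\frac12\sum_{\substack{a=1\\ p\nmid a}}^{fp^n}(-1)^{a+1}\,\chi\omega^{-1}(a)\,\frac{1}{\langle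 a\rangle^{s}},$$ where for $\chi=1$ and $s=1$ the left side is understood as its limit as $s\to 1$, $s\ne 1$. (2) Let $i\in\{1,\dots,p-2\}$ be odd and let $\zeta_{p,i}(s)=L_p(s,\omega^{1-i})$ be the corresponding branch of the $p$-adic zeta function. Then for all $s\in\mathbb{C}_p$ with $|s|<p^{(p-2)/(p-1)}$, other than $s=1$ in case $\omega(2)^{1-i}=1$, one has $1-\omega(2)^{1-i}\langle 2\rangle^{1-s}\neq 0$ and $$\zeta_{p,i}(s)=\frac{1}{1-\omega(2)^{1-i}\langle 2\rangle^{1-s}}\cdot\lim_{n\to\infty}\frac12\sum_{\substack{a=1\\ p\nmid a}}^{p^n}(-1)^{a+1}\,\omega(a)^{-i}\,\frac{1}{\langle a\rangle^{s}}.$$ Existence of all limits is part of the claim. -/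

import Mathlib

open Filter Topology

noncomputable section

namespace KW

variable (p : ℕ) [Fact p.Prime]

/-- The Teichmüller lift `ω : ℤ/p → ℤ_p`, through the identification of `ℤ_p` with the ring of
Witt vectors of `ℤ/p`. -/
def teichLift : ZMod p →* ℤ_[p] :=
  ((WittVector.equiv p).toRingHom : WittVector p (ZMod p) →* ℤ_[p]).comp (WittVector.teichmuller p)

theorem teichLift_zero : teichLift p 0 = 0 := by
  simp [teichLift]

/-- There is only one ring homomorphism `ℤ_p → ℤ/p`. -/
theorem ringHom_eq_toZMod (f : ℤ_[p] →+* ZMod p) (x : ℤ_[p]) : f x = PadicInt.toZMod x := by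
  have h : x - (PadicInt.zmodRepr x : ℤ_[p]) ∈ Ideal.span {(p : ℤ_[p])} := by
    rw [← PadicInt.maximalIdeal_eq_span_p]
    exact PadicInt.sub_zmodRepr_mem x
  obtain ⟨y, hy⟩ := Ideal.mem_span_singleton'.mp h
  have hx : x = (PadicInt.zmodRepr x : ℤ_[p]) + y * p := by rw [hy]; ring
  rw [hx]
  simp

/-- The defining property of the Teichmüller lift: `ω(a)` reduces to `a` modulo `p`
(and `ω(a) ^ p = ω(a)`, as `ω` is multiplicative). -/
theorem toZMod_teichLift (a : ZMod p) : PadicInt.toZMod (teichLift p a) = a := by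
  have h := ringHom_eq_toZMod p
    ((WittVector.constantCoeff : WittVector p (ZMod p) →+* ZMod p).comp
      (WittVector.equiv p).symm.toRingHom) (teichLift p a)
  rw [← h]
  simp [teichLift]

/-- The Teichmüller character `ω` as a Dirichlet character modulo `p` with values in `ℂ_p`
(for odd `p`, where the modulus is `q = p`). -/
def teich : DirichletCharacter ℂ_[p] p where
  toFun a := algebraMap ℚ_[p] ℂ_[p] (teichLift p a : ℚ_[p])
  map_one' := by simp
  map_mul' a b := by simp
  map_nonunit' a ha := by
    have : a = 0 := by
      by_contra h
      exact ha (isUnit_iff_ne_zero.mpr h)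
    simp [this, teichLift_zero]

variable {p}

/-- `⟨a⟩ = ω(a)⁻¹ a`, for an integer `a` prime to `p`. -/
def angle (a : ℕ) : ℂ_[p] := (teich p (a : ZMod p))⁻¹ * (a : ℂ_[p])

/-- The `p`-adic power `x ^ s = ∑ⱼ (s choose j) (x - 1)ʲ`. -/
def ppow (x s : ℂ_[p]) : ℂ_[p] := ∑' j : ℕ, Ring.choose s j * (x - 1) ^ j

variable (p) in
/-- The radius `q p ^ (-1/(p-1)) = p ^ ((p-2)/(p-1))` of the domain of `L_p`, for odd `p`. -/
def radius : ℝ := (p : ℝ) ^ (((p : ℝ) - 2) / ((p : ℝ) - 1))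

/-- The generalized Bernoulli number
`B_{n,ψ} = f ^ (n-1) ∑_{a=1}^f ψ(a) B_n(a/f)`, for `ψ` a Dirichlet character modulo `f`
and `n ≥ 1`. Here `B_n(X)` is the Bernoulli polynomial. -/
def genBernoulli {f : ℕ} (ψ : DirichletCharacter ℂ_[p] f) (n : ℕ) : ℂ_[p] :=
  (f : ℂ_[p]) ^ (n - 1) * ∑ a ∈ Finset.Icc 1 f,
    ψ (a : ZMod f) * Polynomial.aeval ((a : ℂ_[p]) / (f : ℂ_[p])) (Polynomial.bernoulli n)

/-- The primitive Dirichlet character `χ ω⁻ⁿ`. -/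
def twist {f : ℕ} (χ : DirichletCharacter ℂ_[p] f) (n : ℕ) :
    DirichletCharacter ℂ_[p] (χ.mul (teich p ^ n)⁻¹).conductor :=
  χ.primitive_mul (teich p ^ n)⁻¹

/-- `g` is given on the open disc `|s| < p ^ ((p-2)/(p-1))` outside the set `S`
by one convergent power series. -/
def AnalyticOnDiscOff (S : Set ℂ_[p]) (g : ℂ_[p] → ℂ_[p]) : Prop :=
  ∃ c : ℕ → ℂ_[p], (∀ s : ℂ_[p], ‖s‖ < radius p → Summable fun n => c n * s ^ n) ∧
    ∀ s : ℂ_[p], ‖s‖ < radius p → s ∉ S → g s = ∑' n, c n * s ^ n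

/-- The characterization of the Kubota-Leopoldt `p`-adic `L`-function (`p` odd) of the primitive
character attached to `χ`: on the disc `|s| < p ^ ((p-2)/(p-1))` it is analytic, except for at most
a simple pole at `s = 1` if `χ = 1`, and
`L_p(1-n, χ) = -(1 - χω⁻ⁿ(p) p ^ (n-1)) B_{n,χω⁻ⁿ} / n` for all `n ≥ 1`. -/
structure IsPadicLFunction {f : ℕ} (χ : DirichletCharacter ℂ_[p] f) (L : ℂ_[p] → ℂ_[p]) :
    Prop where
  analytic : χ ≠ 1 → AnalyticOnDiscOff ∅ L
  meromorphic : χ = 1 → AnalyticOnDiscOff {1} fun s => (s - 1) * L s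
  interpolation : ∀ n : ℕ, 1 ≤ n →
    L (1 - (n : ℂ_[p])) =
      -(1 - twist χ n (p : ZMod _) * (p : ℂ_[p]) ^ (n - 1)) * genBernoulli (twist χ n) n
        / (n : ℂ_[p])

/-- The `p`-adic `L`-function `L_p(s, χ)` (`p` odd). Its values matter on the disc
`|s| < p ^ ((p-2)/(p-1))` only, and not at the pole `s = 1` if `χ = 1`; there it is uniquely
determined by its characterization. -/
def padicL {f : ℕ} (χ : DirichletCharacter ℂ_[p] f) : ℂ_[p] → ℂ_[p] :=
  Classical.epsilon (IsPadicLFunction χ)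

variable (p) in
/-- The branch `ζ_{p,i}(s) = L_p(s, ω^(1-i))` of the `p`-adic zeta function. -/
def padicZeta (i : ℕ) : ℂ_[p] → ℂ_[p] := padicL (teich p ^ (1 - (i : ℤ)))

/-- `½ ∑_{a ≤ f pⁿ, p ∤ a} (-1)^(a+1) χω⁻¹(a) / ⟨a⟩^s`. For `p ∤ a` the value at `a` of the
primitive character `χω⁻¹` is `χ(a) ω(a)⁻¹` when `χ` is primitive. -/
def altSum {f : ℕ} (χ : DirichletCharacter ℂ_[p] f) (s : ℂ_[p]) (n : ℕ) : ℂ_[p] :=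
  1 / 2 * ∑ a ∈ (Finset.Icc 1 (f * p ^ n)).filter (fun a => ¬ p ∣ a),
    (-1) ^ (a + 1) * (χ (a : ZMod f) * (teich p (a : ZMod p))⁻¹) * (1 / ppow (angle a) s)

end KW

end

/-!
Write `R = p ^ ((p-2)/(p-1))`, and let `g(s)` be the limit of the alternating sums
`½ ∑ (-1)^(a+1) χω⁻¹(a) ⟨a⟩^(-s)`. The proof shows that `g` exists and is a power series on the disc
`|s| < R`, checks the identity `g(s) = (1 - χ(2)⟨2⟩^(1-s)) L_p(s, χ)` at the integers `s = -l ≤ 0`,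
and concludes by the identity theorem, since these integers accumulate at the centre `0` of the disc
(`IsPowerSeriesOn.eqOn_of_frequently_eq`).

The analytic input is that a binomial series `∑ⱼ (±s + b choose j) aⱼ` with `|aⱼ| ≤ C p^(-j)` is a
bounded power series on that disc, because `|1/j!| ≤ p^(j/(p-1))`
(`exists_isPowerSeriesOn_choose`).

* *Existence of `L_p`.* The function `L_p` is defined by its characterization only, so it has to be
  constructed. With `F = f p`, the series `1/F ∑ χ(a) ⟨a⟩^(1-s) ∑ⱼ (1-s choose j) (F/a)ʲ Bⱼ`, over
  the `a ≤ F` prime to `p`, is a bounded power series, because `|Bⱼ| ≤ p` by von Staudt-Clausen.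
  At `s = 1 - n` it is a Bernoulli sum over the period `F`, which the multiplication theorem of the
  Bernoulli polynomials identifies with `(1 - χω⁻ⁿ(p) p^(n-1)) B_{n,χω⁻ⁿ}`
  (`bernoulliSum_twistFun`). If `χ ≠ 1` it vanishes at `s = 1`, and a bounded power series on a disc
  of radius greater than `1` that vanishes at `1` is divisible by `s - 1`. Hence its quotient by
  `s - 1` has the required properties (`exists_isPadicLFunction`).

* *Values at `s = -l`.* There the alternating sum is `½ ∑ (-1)^(a+1) ψ(a) a^l` with `ψ` of odd
  period. Summing by Euler polynomials gives it in closed form as a polynomial expression in `pⁿ`,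
  whose value at `0` is the limit. Expressing Euler polynomials through Bernoulli polynomials turns
  this value into `(1 - χ(2)⟨2⟩^(l+1)) L_p(-l, χ)` (`tendsto_alternating_sum`,
  `tendsto_altSum_neg_natCast`).

* *The other `s`.* Expanding `⟨a⟩^(-s) = ∑ⱼ (-s choose j) (⟨a⟩ - 1)ʲ` writes the alternating sum as
  a binomial series in the alternating moments of `(⟨a⟩ - 1)ʲ`. These are bounded by `p^(-j)` and
  are finite combinations of the alternating sums at `s = 0, -1, …, -j`, hence converge; dominated
  convergence gives the limit as a binomial series (`exists_limit_altSum`).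

For the branches of the zeta function, the factor `1 - ω(b)⟨2⟩^(1-s)` has no zeros besides `s = 1`
for `ω(b) = 1`: either `ω(b)` is not congruent to `1`, or the term `u (⟨2⟩ - 1)` with `u = 1 - s`
strictly dominates the expansion of `⟨2⟩^u - 1` (`one_sub_teich_mul_ppow_ne_zero`).
-/

namespace KW

/-! ### Power series on an open disc -/

section PowerSeries

variable {K : Type*} [NontriviallyNormedField K]

/-- `g` is given on the open disc `‖s‖ < R` by the convergent power series with coefficients `c`. -/
def IsPowerSeriesOn (R : ℝ) (c : ℕ → K) (g : K → K) : Prop :=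
  ∀ s : K, ‖s‖ < R → HasSum (fun n => c n * s ^ n) (g s)

/-- The power series with coefficients `c` is bounded on the open disc of radius `R`. -/
def HasBoundedCoeffs (R : ℝ) (c : ℕ → K) : Prop :=
  ∃ C : ℝ, ∀ n, ‖c n‖ * R ^ n ≤ C

theorem IsPowerSeriesOn.sub {R : ℝ} {c d : ℕ → K} {g h : K → K} (hg : IsPowerSeriesOn R c g)
    (hh : IsPowerSeriesOn R d h) :
    IsPowerSeriesOn R (fun n => c n - d n) (fun s => g s - h s) := by
  intro s hs
  simpa only [sub_mul] using (hg s hs).sub (hh s hs)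

theorem IsPowerSeriesOn.const_mul {R : ℝ} {c : ℕ → K} {g : K → K} (a : K)
    (hg : IsPowerSeriesOn R c g) :
    IsPowerSeriesOn R (fun n => a * c n) (fun s => a * g s) := by
  intro s hs
  simpa only [mul_assoc] using (hg s hs).mul_left a

theorem IsPowerSeriesOn.sum {ι : Type*} {R : ℝ} {c : ι → ℕ → K} {g : ι → K → K} (t : Finset ι)
    (hg : ∀ i ∈ t, IsPowerSeriesOn R (c i) (g i)) :
    IsPowerSeriesOn R (fun n => ∑ i ∈ t, c i n) (fun s => ∑ i ∈ t, g i s) := by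
  intro s hs
  simpa only [Finset.sum_mul] using hasSum_sum fun i hi => hg i hi s hs

theorem isPowerSeriesOn_const (R : ℝ) (a : K) :
    IsPowerSeriesOn R (fun n => if n = 0 then a else 0) (fun _ => a) := by
  intro s _
  convert hasSum_ite_eq 0 a using 2 with n
  split_ifs with h <;> simp [h]

theorem isPowerSeriesOn_id (R : ℝ) :
    IsPowerSeriesOn R (fun n => if n = 1 then (1 : K) else 0) (fun s => s) := by
  intro s _
  convert hasSum_ite_eq 1 s using 2 with n
  split_ifs with h <;> simp [h]

theorem HasBoundedCoeffs.const_mul {R : ℝ} {c : ℕ → K} (a : K) (hc : HasBoundedCoeffs R c) :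
    HasBoundedCoeffs R (fun n => a * c n) := by
  obtain ⟨C, hC⟩ := hc
  refine ⟨‖a‖ * C, fun n => ?_⟩
  rw [norm_mul, mul_assoc]
  exact mul_le_mul_of_nonneg_left (hC n) (norm_nonneg _)

theorem HasBoundedCoeffs.sum {ι : Type*} {R : ℝ} (hR : 0 ≤ R) {c : ι → ℕ → K} (t : Finset ι)
    (hc : ∀ i ∈ t, HasBoundedCoeffs R (c i)) :
    HasBoundedCoeffs R (fun n => ∑ i ∈ t, c i n) := by
  choose! C hC using hc
  refine ⟨∑ i ∈ t, C i, fun n => ?_⟩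
  calc ‖∑ i ∈ t, c i n‖ * R ^ n ≤ (∑ i ∈ t, ‖c i n‖) * R ^ n :=
        mul_le_mul_of_nonneg_right (norm_sum_le _ _) (by positivity)
    _ = ∑ i ∈ t, ‖c i n‖ * R ^ n := Finset.sum_mul _ _ _
    _ ≤ ∑ i ∈ t, C i := Finset.sum_le_sum fun i hi => hC i hi n

/-- Two power series on a disc agree there as soon as they agree at points accumulating at the
centre. -/
theorem IsPowerSeriesOn.eqOn_of_frequently_eq [CompleteSpace K] {R : ℝ} (hR : 0 < R)
    {c d : ℕ → K} {g h : K → K}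
    (hg : IsPowerSeriesOn R c g) (hh : IsPowerSeriesOn R d h)
    (hfr : ∃ᶠ s in 𝓝[≠] (0 : K), g s = h s) {s : K} (hs : ‖s‖ < R) : g s = h s := by
  have key := hg.sub hh
  set e : ℕ → K := fun n => c n - d n with he
  obtain ⟨t, ht0, htR⟩ := NormedField.exists_norm_lt K hR
  have hrad : (‖t‖₊ : ENNReal) ≤ (FormalMultilinearSeries.ofScalars K e).radius := by
    apply FormalMultilinearSeries.le_radius_of_tendsto (l := 0)
    have := (key t htR).summable.tendsto_atTop_zero.norm
    rw [norm_zero] at this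
    refine this.congr fun n => ?_
    rw [FormalMultilinearSeries.ofScalars_norm, norm_mul, norm_pow, coe_nnnorm]
  have hball : HasFPowerSeriesOnBall (fun s => g s - h s) (FormalMultilinearSeries.ofScalars K e) 0
      ‖t‖₊ := by
    refine ⟨hrad, by simpa using ht0, fun {y} hy => ?_⟩
    have hy' : ‖y‖ < R := by
      have : ‖y‖₊ < ‖t‖₊ := by
        simpa only [Metric.mem_eball, edist_zero_right, enorm_eq_nnnorm,
          ENNReal.coe_lt_coe] using hy
      exact lt_trans (by exact_mod_cast this) htR
    simpa only [FormalMultilinearSeries.ofScalars_apply_eq, zero_add, smul_eq_mul] using key y hy'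
  have hz : ∀ᶠ z in 𝓝 (0 : K), g z - h z = 0 := by
    rw [← hball.analyticAt.frequently_zero_iff_eventually_zero]
    exact hfr.mono fun z hz => sub_eq_zero.2 hz
  have h0 : FormalMultilinearSeries.ofScalars K e = 0 :=
    (hball.hasFPowerSeriesAt.congr hz).eq_zero
  have he0 : e = 0 := (FormalMultilinearSeries.ofScalars_series_eq_zero K).1 h0
  have h1 := key s hs
  have h2 : (fun n => (c n - d n) * s ^ n) = fun _ => (0 : K) := by
    funext n
    have := congrFun he0 n
    simp only [he, Pi.zero_apply] at this
    rw [this, zero_mul]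
  rw [h2] at h1
  exact sub_eq_zero.1 (h1.unique hasSum_zero)

theorem IsPowerSeriesOn.continuousAt [CompleteSpace K] {R : ℝ} (hR : 0 < R) {c : ℕ → K} {g : K → K}
    (hg : IsPowerSeriesOn R c g) (hc : HasBoundedCoeffs R c) {s : K} (hs : ‖s‖ < R) :
    ContinuousAt g s := by
  lift R to NNReal using hR.le
  obtain ⟨C, hC⟩ := hc
  have hball : HasFPowerSeriesOnBall g (FormalMultilinearSeries.ofScalars K c) 0 R := by
    refine ⟨FormalMultilinearSeries.le_radius_of_bound _ C fun n => ?_, by simpa using hR,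
      fun {y} hy => ?_⟩
    · rw [FormalMultilinearSeries.ofScalars_norm]
      exact hC n
    · have hy' : ‖y‖₊ < R := by
        simpa only [Metric.mem_eball, edist_zero_right, enorm_eq_nnnorm,
          ENNReal.coe_lt_coe] using hy
      simpa only [FormalMultilinearSeries.ofScalars_apply_eq, zero_add, smul_eq_mul] using hg y hy'
  refine hball.continuousOn.continuousAt (Metric.isOpen_eball.mem_nhds ?_)
  have : ‖s‖₊ < R := hs
  simpa only [Metric.mem_eball, edist_zero_right, enorm_eq_nnnorm, ENNReal.coe_lt_coe] using this

variable [IsUltrametricDist K]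

theorem IsPowerSeriesOn.mul [CompleteSpace K] {R : ℝ} {c d : ℕ → K} {g h : K → K}
    (hg : IsPowerSeriesOn R c g) (hh : IsPowerSeriesOn R d h) :
    IsPowerSeriesOn R (fun n => ∑ ij ∈ Finset.HasAntidiagonal.antidiagonal n, c ij.1 * d ij.2)
      (fun s => g s * h s) := by
  intro s hs
  have : NonarchimedeanRing K :=
    { is_nonarchimedean := NonarchimedeanAddGroup.is_nonarchimedean }
  have h1 := (hg s hs).summable
  have h2 := (hh s hs).summable
  have h3 := h1.mul_of_nonarchimedean h2
  have h4 := h1.tsum_mul_tsum_eq_tsum_sum_antidiagonal h2 h3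
  have h5 := summable_sum_mul_antidiagonal_of_summable_mul (f := fun n => c n * s ^ n)
    (g := fun n => d n * s ^ n) h3
  rw [(hg s hs).tsum_eq, (hh s hs).tsum_eq] at h4
  simp only at h4 ⊢
  rw [h4]
  have h6 : ∀ n, (∑ ij ∈ Finset.HasAntidiagonal.antidiagonal n, c ij.1 * d ij.2) * s ^ n
      = ∑ ij ∈ Finset.HasAntidiagonal.antidiagonal n, c ij.1 * s ^ ij.1 * (d ij.2 * s ^ ij.2) := by
    intro n
    rw [Finset.sum_mul]
    refine Finset.sum_congr rfl fun ij hij => ?_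
    rw [← Finset.HasAntidiagonal.mem_antidiagonal.1 hij, pow_add]
    ring
  simp only [h6]
  exact h5.hasSum

theorem HasBoundedCoeffs.mul {R : ℝ} (hR : 0 ≤ R) {c d : ℕ → K} (hc : HasBoundedCoeffs R c)
    (hd : HasBoundedCoeffs R d) :
    HasBoundedCoeffs R (fun n => ∑ ij ∈ Finset.HasAntidiagonal.antidiagonal n, c ij.1 * d ij.2) := by
  obtain ⟨C, hC⟩ := hc
  obtain ⟨D, hD⟩ := hd
  have hC0 : 0 ≤ C := le_trans (by positivity) (hC 0)
  refine ⟨C * D, fun n => ?_⟩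
  obtain ⟨ij, hij, hle⟩ := IsUltrametricDist.exists_norm_finsetSum_le_of_nonempty
    (t := Finset.HasAntidiagonal.antidiagonal n) ⟨(0, n), by simp⟩ (fun ij => c ij.1 * d ij.2)
  calc ‖∑ ij ∈ Finset.HasAntidiagonal.antidiagonal n, c ij.1 * d ij.2‖ * R ^ n
      ≤ ‖c ij.1 * d ij.2‖ * R ^ n := mul_le_mul_of_nonneg_right hle (by positivity)
    _ = (‖c ij.1‖ * R ^ ij.1) * (‖d ij.2‖ * R ^ ij.2) := by
        rw [norm_mul, ← Finset.HasAntidiagonal.mem_antidiagonal.1 hij, pow_add]; ring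
    _ ≤ C * D := mul_le_mul (hC _) (hD _) (by positivity) hC0

/-- A bounded power series on a disc of radius `R > 1` that vanishes at `1` is divisible by
`s - 1`: the coefficients of the quotient are the tails `∑_{j > k} c j`. -/
theorem IsPowerSeriesOn.exists_mul_sub_one [CompleteSpace K] {R : ℝ} (hR : 1 < R) {c : ℕ → K}
    {g : K → K} (hg : IsPowerSeriesOn R c g) (hc : HasBoundedCoeffs R c) (h1 : g 1 = 0) :
    ∃ (d : ℕ → K) (q : K → K), IsPowerSeriesOn R d q ∧ ∀ s, ‖s‖ < R → g s = (s - 1) * q s := by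
  have hR0 : 0 < R := one_pos.trans hR
  obtain ⟨C, hC⟩ := hc
  have hC0 : 0 ≤ C := le_trans (by positivity) (hC 0)
  have hsum : HasSum c 0 := by simpa [h1] using hg 1 (by simpa using hR)
  obtain ⟨d, hd⟩ : ∃ d : ℕ → K, ∀ k, d k = ∑' j, c (j + (k + 1)) := ⟨_, fun _ => rfl⟩
  have hrec : ∀ k, d k = c (k + 1) + d (k + 1) := fun k => by
    have hs : Summable fun j => c (j + (k + 1)) :=
      (summable_nat_add_iff (k + 1)).2 hsum.summable
    rw [hd, hd, hs.tsum_eq_zero_add]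
    simp only [zero_add]
    congr 1
    refine tsum_congr fun j => ?_
    congr 1
    ring
  have hd0 : d 0 = - c 0 := by
    have := hsum.summable.tsum_eq_zero_add
    rw [hsum.tsum_eq] at this
    rw [hd]
    simp only [zero_add]
    linear_combination -this
  have hdb : ∀ k, ‖d k‖ ≤ C / R ^ k := fun k => by
    rw [hd]
    refine IsUltrametricDist.norm_tsum_le_of_forall_le_of_nonneg (by positivity) fun j => ?_
    calc ‖c (j + (k + 1))‖ ≤ C / R ^ (j + (k + 1)) := (le_div_iff₀ (by positivity)).2 (hC _)
      _ ≤ C / R ^ k := div_le_div_of_nonneg_left hC0 (by positivity)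
          (pow_le_pow_right₀ hR.le (by omega))
  have hsd : ∀ s : K, ‖s‖ < R → Summable fun n => d n * s ^ n := fun s hs => by
    have hgeo : Summable fun n : ℕ => C * (‖s‖ / R) ^ n :=
      (summable_geometric_of_lt_one (by positivity) ((div_lt_one hR0).2 hs)).mul_left C
    refine Summable.of_norm_bounded hgeo fun n => ?_
    rw [norm_mul, norm_pow, div_pow, ← mul_div_assoc, mul_div_right_comm]
    exact mul_le_mul_of_nonneg_right (hdb n) (by positivity)
  refine ⟨d, fun s => ∑' n, d n * s ^ n, fun s hs => (hsd s hs).hasSum, fun s hs => ?_⟩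
  have hS := hsd s hs
  have hS' : Summable fun n => d (n + 1) * s ^ (n + 1) :=
    (summable_nat_add_iff (f := fun n => d n * s ^ n) 1).2 hS
  have hcs := (hg s hs).summable
  have hcs' : Summable fun n => c (n + 1) * s ^ (n + 1) :=
    (summable_nat_add_iff (f := fun n => c n * s ^ n) 1).2 hcs
  have e1 : ∑' n, c n * s ^ n = c 0 + ∑' n, c (n + 1) * s ^ (n + 1) := by
    rw [hcs.tsum_eq_zero_add]; simp
  have e2 : ∑' n, d n * s ^ n = d 0 + ∑' n, d (n + 1) * s ^ (n + 1) := by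
    rw [hS.tsum_eq_zero_add]; simp
  have e3 : s * ∑' n, d n * s ^ n
      = ∑' n, c (n + 1) * s ^ (n + 1) + ∑' n, d (n + 1) * s ^ (n + 1) := by
    rw [← hcs'.tsum_add hS', ← tsum_mul_left]
    refine tsum_congr fun n => ?_
    rw [hrec n]; ring
  -- `d k = c (k + 1) + d (k + 1)` and `d 0 = -c 0`, so the series for `s q(s) - q(s)` telescopes.
  rw [← (hg s hs).tsum_eq, sub_mul, one_mul, e3, e1]
  change _ = _ - ∑' n, d n * s ^ n
  rw [e2, hd0]
  ring

end PowerSeries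

/-! ### Binomial series and `p`-adic powers -/

section BinomialSeries

variable {p : ℕ} [Fact p.Prime]

theorem norm_natCast (n : ℕ) : ‖(n : ℂ_[p])‖ = ‖(n : ℚ_[p])‖ := by
  rw [← map_natCast (algebraMap ℚ_[p] ℂ_[p]), norm_algebraMap']

theorem norm_natCast_self : ‖(p : ℂ_[p])‖ = (p : ℝ)⁻¹ := by
  rw [norm_natCast, Padic.norm_p]

theorem norm_natCast_eq_one {n : ℕ} (h : ¬ p ∣ n) : ‖(n : ℂ_[p])‖ = 1 := by
  rw [norm_natCast]
  refine le_antisymm (IsUltrametricDist.norm_natCast_le_one _ n) (not_lt.1 fun hlt => h ?_)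
  have := (Padic.norm_intCast_lt_one_iff (p := p) (k := (n : ℤ))).1 (by simpa using hlt)
  exact_mod_cast this

variable (p) in
/-- The number `p ^ (1/(p-1))`, which is the growth rate of `‖1/j!‖`. -/
noncomputable def factRate : ℝ := (p : ℝ) ^ (1 / ((p : ℝ) - 1))

theorem one_lt_prime : 1 < (p : ℝ) := by exact_mod_cast (Fact.out : p.Prime).one_lt

theorem one_lt_factRate : 1 < factRate p :=
  Real.one_lt_rpow one_lt_prime (one_div_pos.2 (sub_pos.2 one_lt_prime))

theorem factRate_pow : factRate p ^ (p - 1) = p := by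
  have h1 : (1 : ℝ) < p := one_lt_prime
  rw [factRate, ← Real.rpow_natCast, ← Real.rpow_mul (by positivity),
    Nat.cast_sub (Fact.out : p.Prime).one_lt.le, Nat.cast_one,
    one_div_mul_cancel (sub_pos.2 h1).ne', Real.rpow_one]

theorem radius_eq : radius p = p / factRate p := by
  have h1 : (1 : ℝ) < p := one_lt_prime
  have h2 : (p : ℝ) - 1 ≠ 0 := (sub_pos.2 h1).ne'
  rw [eq_div_iff (one_pos.trans one_lt_factRate).ne', radius, factRate,
    ← Real.rpow_add (by positivity), ← add_div]
  rw [show (p : ℝ) - 2 + 1 = p - 1 by ring, div_self h2, Real.rpow_one]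

theorem one_lt_radius (hp : p ≠ 2) : 1 < radius p := by
  have h1 : 2 < p := lt_of_le_of_ne (Fact.out : p.Prime).two_le (Ne.symm hp)
  have h2 : (2 : ℝ) < p := by exact_mod_cast h1
  exact Real.one_lt_rpow one_lt_prime (div_pos (by linarith) (by linarith))

/-- Legendre's formula: `(p - 1) v_p(j!) ≤ j - 1`. -/
theorem norm_inv_factorial_le {j : ℕ} (hj : j ≠ 0) :
    ‖((j.factorial : ℂ_[p]))⁻¹‖ ≤ factRate p ^ (j - 1) := by
  have hne : (j.factorial : ℚ_[p]) ≠ 0 := by exact_mod_cast j.factorial_ne_zero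
  rw [norm_inv, norm_natCast, Padic.norm_eq_zpow_neg_valuation hne, Padic.valuation_natCast,
    zpow_neg, inv_inv, zpow_natCast]
  have h := sub_one_mul_padicValNat_factorial_lt_of_ne_zero p hj
  calc (p : ℝ) ^ padicValNat p j.factorial
      = factRate p ^ ((p - 1) * padicValNat p j.factorial) := by rw [pow_mul, factRate_pow]
    _ ≤ factRate p ^ (j - 1) := pow_le_pow_right₀ one_lt_factRate.le (by omega)

theorem norm_inv_factorial_le' (j : ℕ) : ‖((j.factorial : ℂ_[p]))⁻¹‖ ≤ factRate p ^ j := by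
  rcases eq_or_ne j 0 with rfl | hj
  · simp
  · exact (norm_inv_factorial_le hj).trans (pow_le_pow_right₀ one_lt_factRate.le (by omega))

theorem choose_eq_inv_factorial_mul_aeval (s : ℂ_[p]) (j : ℕ) :
    Ring.choose s j = (j.factorial : ℂ_[p])⁻¹ * Polynomial.aeval s (descPochhammer ℤ j) := by
  rw [eq_inv_mul_iff_mul_eq₀ (by exact_mod_cast j.factorial_ne_zero), ← nsmul_eq_mul,
    ← Ring.descPochhammer_eq_factorial_smul_choose, Polynomial.aeval_eq_smeval]

/-- An integral polynomial of degree at most `j` grows at most like `M ^ j`. -/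
theorem norm_aeval_le {s : ℂ_[p]} {M : ℝ} (hM : 1 ≤ M) (hs : ‖s‖ ≤ M) {q : Polynomial ℤ} {j : ℕ}
    (hq : q.natDegree ≤ j) : ‖Polynomial.aeval s q‖ ≤ M ^ j := by
  rw [Polynomial.aeval_eq_sum_range]
  refine IsUltrametricDist.norm_sum_le_of_forall_le_of_nonneg (by positivity) fun i hi => ?_
  rw [zsmul_eq_mul, norm_mul, norm_pow]
  have hi' : i ≤ j := by have := Finset.mem_range.1 hi; omega
  calc _ ≤ 1 * M ^ i := mul_le_mul (IsUltrametricDist.norm_intCast_le_one _ _)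
        (pow_le_pow_left₀ (norm_nonneg _) hs i) (by positivity) one_pos.le
    _ ≤ M ^ j := by rw [one_mul]; exact pow_le_pow_right₀ hM hi'

theorem norm_choose_le {s : ℂ_[p]} {M : ℝ} (hM : 1 ≤ M) (hs : ‖s‖ ≤ M) (j : ℕ) :
    ‖Ring.choose s j‖ ≤ (M * factRate p) ^ j := by
  rw [choose_eq_inv_factorial_mul_aeval, norm_mul, mul_pow, mul_comm]
  exact mul_le_mul (norm_aeval_le hM hs (by simp)) (norm_inv_factorial_le' j)
    (norm_nonneg _) (by positivity)

theorem mul_factRate_div (M : ℝ) : M * factRate p / p = M / radius p := by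
  rw [radius_eq, div_div_eq_mul_div]

/-- The terms of a binomial series `∑ (s choose j) a j`, with `a j` of size at most `C p ^ (-j)`,
decay geometrically on the open disc of radius `p ^ ((p-2)/(p-1))`. -/
theorem norm_choose_mul_le {s a : ℂ_[p]} {C M : ℝ} (hM : 1 ≤ M) (hs : ‖s‖ ≤ M) {j : ℕ}
    (ha : ‖a‖ ≤ C / (p : ℝ) ^ j) : ‖Ring.choose s j * a‖ ≤ C * (M / radius p) ^ j := by
  have h0 : (0 : ℝ) < factRate p := one_pos.trans one_lt_factRate
  rw [norm_mul]
  calc _ ≤ (M * factRate p) ^ j * (C / (p : ℝ) ^ j) :=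
        mul_le_mul (norm_choose_le hM hs j) ha (norm_nonneg _) (by positivity)
    _ = C * (M / radius p) ^ j := by rw [← mul_factRate_div, div_pow]; ring

theorem summable_geometric_max (hp : p ≠ 2) {s : ℂ_[p]} (hs : ‖s‖ < radius p) (C : ℝ) :
    Summable fun j : ℕ => C * (max 1 ‖s‖ / radius p) ^ j := by
  have hR := one_lt_radius hp
  have hR0 : 0 < radius p := one_pos.trans hR
  exact (summable_geometric_of_lt_one (by positivity)
    ((div_lt_one hR0).2 (max_lt hR hs))).mul_left C

theorem summable_choose_mul (hp : p ≠ 2) {s : ℂ_[p]} (hs : ‖s‖ < radius p) {a : ℕ → ℂ_[p]} {C : ℝ}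
    (ha : ∀ j, ‖a j‖ ≤ C / (p : ℝ) ^ j) : Summable fun j => Ring.choose s j * a j :=
  Summable.of_norm_bounded (summable_geometric_max hp hs C)
    fun j => norm_choose_mul_le (le_max_left _ _) (le_max_right _ _) (ha j)

/-- A binomial series `∑ (q(s) choose j) a j`, with `q` an integral polynomial of degree at most `1`
and `a j` of size at most `C p ^ (-j)`, is a bounded power series in `s` on the open disc of radius
`p ^ ((p-2)/(p-1))`: each term is `a j / j!` times an integral polynomial of degree at most `j`. -/
theorem exists_isPowerSeriesOn_choose (hp : p ≠ 2) {q : Polynomial ℤ} (hq : q.natDegree ≤ 1)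
    {a : ℕ → ℂ_[p]} {C : ℝ} (ha : ∀ j, ‖a j‖ ≤ C / (p : ℝ) ^ j) :
    ∃ c : ℕ → ℂ_[p], HasBoundedCoeffs (radius p) c ∧
      IsPowerSeriesOn (radius p) c
        (fun s => ∑' j, Ring.choose (Polynomial.aeval s q) j * a j) := by
  have hR := one_lt_radius hp
  have hR0 : 0 < radius p := one_pos.trans hR
  have hp0 : (0 : ℝ) < p := one_pos.trans one_lt_prime
  have hC : 0 ≤ C := by simpa using (norm_nonneg _).trans (ha 0)
  obtain ⟨Q, hQ⟩ : ∃ Q : ℕ → Polynomial ℤ, ∀ j, Q j = (descPochhammer ℤ j).comp q :=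
    ⟨_, fun _ => rfl⟩
  have hQd : ∀ j, (Q j).natDegree ≤ j := fun j => by
    rw [hQ]
    refine Polynomial.natDegree_comp_le.trans ?_
    rw [descPochhammer_natDegree]
    exact (Nat.mul_le_mul_left j hq).trans (by omega)
  obtain ⟨u, hu⟩ : ∃ u : ℕ → ℕ → ℂ_[p], ∀ j k, u j k =
      a j * (j.factorial : ℂ_[p])⁻¹ * ((Q j).coeff k : ℂ_[p]) := ⟨_, fun _ _ => rfl⟩
  have hu0 : ∀ j k, j < k → u j k = 0 := fun j k hjk => by
    rw [hu, Polynomial.coeff_eq_zero_of_natDegree_lt ((hQd j).trans_lt hjk)]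
    simp
  have hub : ∀ j k, ‖u j k‖ ≤ C / radius p ^ j := fun j k => by
    rw [hu, norm_mul, norm_mul]
    calc _ ≤ C / (p : ℝ) ^ j * factRate p ^ j * 1 := by
          have := one_pos.trans (one_lt_factRate (p := p))
          gcongr
          · exact ha j
          · exact norm_inv_factorial_le' j
          · exact IsUltrametricDist.norm_intCast_le_one _ _
      _ = C / radius p ^ j := by
          rw [radius_eq, div_pow, div_div_eq_mul_div, mul_one, div_mul_eq_mul_div]
  refine ⟨fun k => ∑' j, u j k, ⟨C, fun k => ?_⟩, fun s hs => ?_⟩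
  · rw [← le_div_iff₀ (by positivity)]
    refine IsUltrametricDist.norm_tsum_le_of_forall_le_of_nonneg (by positivity) fun j => ?_
    rcases lt_or_ge j k with h | h
    · rw [hu0 j k h, norm_zero]; positivity
    · exact (hub j k).trans (div_le_div_of_nonneg_left hC (by positivity)
        (pow_le_pow_right₀ hR.le h))
  · obtain ⟨M, hM⟩ : ∃ M : ℝ, M = max 1 ‖s‖ := ⟨_, rfl⟩
    have hM1 : 1 ≤ M := hM ▸ le_max_left _ _
    have hMR : M / radius p < 1 := (div_lt_one hR0).2 (hM ▸ max_lt hR hs)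
    obtain ⟨r, hr⟩ : ∃ r : ℝ, r = √(M / radius p) := ⟨_, rfl⟩
    have hr0 : 0 ≤ r := hr ▸ Real.sqrt_nonneg _
    have hr2 : r ^ 2 = M / radius p := by rw [hr, Real.sq_sqrt (by positivity)]
    have hr1 : r < 1 := by
      rw [hr, ← Real.sqrt_one]; exact Real.sqrt_lt_sqrt (by positivity) hMR
    -- As `u j k = 0` for `k > j`, the bound `C (M / R) ^ j = C r ^ (2 * j)` is at most
    -- `C r ^ k * r ^ j`, which is summable over all pairs.
    have hbound : ∀ x : ℕ × ℕ, ‖u x.2 x.1 * s ^ x.1‖ ≤ C * (r ^ x.1 * r ^ x.2) := by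
      rintro ⟨k, j⟩
      simp only
      rcases lt_or_ge j k with h | h
      · rw [hu0 j k h, zero_mul, norm_zero]; positivity
      · rw [norm_mul, norm_pow]
        calc ‖u j k‖ * ‖s‖ ^ k ≤ C / radius p ^ j * M ^ j := by
              refine mul_le_mul (hub j k) ?_ (by positivity) (by positivity)
              exact (pow_le_pow_left₀ (norm_nonneg _) (hM ▸ le_max_right _ _) k).trans
                (pow_le_pow_right₀ hM1 h)
          _ = C * r ^ (2 * j) := by rw [pow_mul, hr2, div_pow]; ring
          _ ≤ C * (r ^ k * r ^ j) := by
              rw [← pow_add]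
              exact mul_le_mul_of_nonneg_left
                (pow_le_pow_of_le_one hr0 hr1.le (by omega)) hC
    have hgeo := summable_geometric_of_lt_one hr0 hr1
    have hF : Summable fun x : ℕ × ℕ => u x.2 x.1 * s ^ x.1 :=
      Summable.of_norm_bounded ((hgeo.mul_of_nonneg hgeo (fun _ => by positivity)
        (fun _ => by positivity)).mul_left C) hbound
    have hinner : ∀ j, ∑' k, u j k * s ^ k = Ring.choose (Polynomial.aeval s q) j * a j := by
      intro j
      rw [tsum_eq_sum (s := Finset.range (j + 1))
        (fun k hk => by rw [hu0 j k (by simpa using hk), zero_mul]),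
        choose_eq_inv_factorial_mul_aeval, ← Polynomial.aeval_comp, ← hQ,
        Polynomial.aeval_eq_sum_range' (Nat.lt_succ_of_le (hQd j)), Finset.mul_sum, Finset.sum_mul]
      refine Finset.sum_congr rfl fun k _ => ?_
      rw [hu, zsmul_eq_mul]
      ring
    have h1 : ∑' x : ℕ × ℕ, u x.2 x.1 * s ^ x.1
        = ∑' j, Ring.choose (Polynomial.aeval s q) j * a j := by
      rw [hF.tsum_prod, Summable.tsum_comm (f := fun j k => u j k * s ^ k)]
      · exact tsum_congr hinner
      · exact hF.prod_symm
    have h2 := hF.hasSum.prod_fiberwise fun k => (hF.prod_factor k).hasSum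
    rw [h1] at h2
    simpa only [tsum_mul_right] using h2

theorem norm_ppow_coeff_le {x : ℂ_[p]} (hx : ‖x - 1‖ ≤ (p : ℝ)⁻¹) (j : ℕ) :
    ‖(x - 1) ^ j‖ ≤ 1 / (p : ℝ) ^ j := by
  rw [norm_pow, one_div, ← inv_pow]
  exact pow_le_pow_left₀ (norm_nonneg _) hx j

theorem ppow_zero (x : ℂ_[p]) : ppow x 0 = 1 := by
  rw [ppow, tsum_eq_single 0]
  · simp
  · intro j hj
    rw [Ring.choose_zero_pos _ (Nat.pos_of_ne_zero hj), zero_mul]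

theorem ppow_natCast (x : ℂ_[p]) (n : ℕ) : ppow x n = x ^ n := by
  rw [ppow, tsum_eq_sum (s := Finset.range (n + 1))]
  · rw [show x ^ n = ((x - 1) + 1) ^ n by ring, add_pow]
    refine Finset.sum_congr rfl fun j _ => ?_
    rw [Ring.choose_natCast]
    ring
  · intro j hj
    rw [Ring.choose_natCast, Nat.choose_eq_zero_of_lt (by simpa using hj)]
    simp

/-- Vandermonde's identity makes the `p`-adic power additive in the exponent. -/
theorem ppow_add (hp : p ≠ 2) {x s t : ℂ_[p]} (hx : ‖x - 1‖ ≤ (p : ℝ)⁻¹) (hs : ‖s‖ < radius p)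
    (ht : ‖t‖ < radius p) : ppow x (s + t) = ppow x s * ppow x t := by
  have : NonarchimedeanRing ℂ_[p] :=
    { is_nonarchimedean := NonarchimedeanAddGroup.is_nonarchimedean }
  have h1 := summable_choose_mul hp hs (norm_ppow_coeff_le hx)
  have h2 := summable_choose_mul hp ht (norm_ppow_coeff_le hx)
  have h3 := h1.mul_of_nonarchimedean h2
  have h4 := h1.tsum_mul_tsum_eq_tsum_sum_antidiagonal h2 h3
  rw [ppow, ppow, ppow, h4]
  refine tsum_congr fun n => ?_
  rw [Ring.add_choose_eq n (Commute.all s t), Finset.sum_mul]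
  refine Finset.sum_congr rfl fun ij hij => ?_
  rw [← Finset.HasAntidiagonal.mem_antidiagonal.1 hij, pow_add]
  ring

theorem one_div_ppow (hp : p ≠ 2) {x s : ℂ_[p]} (hx : ‖x - 1‖ ≤ (p : ℝ)⁻¹)
    (hs : ‖s‖ < radius p) : 1 / ppow x s = ppow x (-s) := by
  have h := ppow_add hp hx hs (t := -s) (by rwa [norm_neg])
  rw [add_neg_cancel, ppow_zero] at h
  exact (eq_one_div_of_mul_eq_one_right h.symm).symm

end BinomialSeries

/-! ### Bernoulli polynomials and periodic sums -/

section Bernoulli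

open Polynomial in
/-- A rational polynomial with a nonzero period is constant. -/
theorem derivative_eq_zero_of_periodic {P : ℚ[X]} {t : ℚ} (ht : t ≠ 0)
    (hP : ∀ x, P.eval (x + t) = P.eval x) : derivative P = 0 := by
  have h1 : ∀ m : ℕ, P.eval (m * t) = P.eval 0 := by
    intro m
    induction m with
    | zero => simp
    | succ m ih => rw [← ih, ← hP (m * t)]; congr 1; push_cast; ring
  have h2 : P = C (P.eval 0) := by
    refine Polynomial.eq_of_infinite_eval_eq _ _ ((Set.infinite_range_of_injective
      (f := fun m : ℕ => (m : ℚ) * t) fun a b hab => ?_).mono ?_)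
    · exact_mod_cast mul_right_cancel₀ ht hab
    · rintro _ ⟨m, rfl⟩
      simpa using h1 m
  rw [h2, derivative_C]

/-- The difference equation of the Bernoulli polynomials. -/
theorem aeval_bernoulli_add_one {K : Type*} [Field K] [CharZero K] (n : ℕ) (x : K) :
    Polynomial.aeval (x + 1) (Polynomial.bernoulli n) =
      Polynomial.aeval x (Polynomial.bernoulli n) + n * x ^ (n - 1) := by
  have h := congrArg (Polynomial.aeval x) (Polynomial.bernoulli_comp_one_add_X n)
  rw [Polynomial.aeval_comp] at h
  simpa [add_comm] using h

open Polynomial in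
/-- The multiplication theorem of the Bernoulli polynomials. The difference of the two sides for
`n + 1` has period `1 / k`, hence is constant; its derivative is a multiple of the difference of the
two sides for `n`. -/
theorem sum_bernoulli_comp (k n : ℕ) (hk : k ≠ 0) :
    C ((k : ℚ) ^ n) * ∑ i ∈ Finset.range k, (Polynomial.bernoulli n).comp (X + C ((i : ℚ) / k)) =
      C (k : ℚ) * (Polynomial.bernoulli n).comp (C (k : ℚ) * X) := by
  have hk' : (k : ℚ) ≠ 0 := by exact_mod_cast hk
  obtain ⟨P, hP⟩ : ∃ P : ℕ → ℚ[X], ∀ n, P n =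
      C ((k : ℚ) ^ n) * ∑ i ∈ Finset.range k, (Polynomial.bernoulli n).comp (X + C ((i : ℚ) / k)) -
      C (k : ℚ) * (Polynomial.bernoulli n).comp (C (k : ℚ) * X) := ⟨_, fun _ => rfl⟩
  have hper : ∀ (n : ℕ) (x : ℚ), (P n).eval (x + 1 / k) = (P n).eval x := by
    intro n x
    have hB : ∀ y : ℚ, (Polynomial.bernoulli n).eval (y + 1) =
        (Polynomial.bernoulli n).eval y + n * y ^ (n - 1) := fun y => by
      rw [add_comm, Polynomial.bernoulli_eval_one_add]
    have e1 : ∑ i ∈ Finset.range k, (Polynomial.bernoulli n).eval (x + 1 / k + i / k) =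
        ∑ i ∈ Finset.range k, (Polynomial.bernoulli n).eval (x + i / k) + n * x ^ (n - 1) := by
      have h1 := Finset.sum_range_succ' (fun i : ℕ => (Polynomial.bernoulli n).eval (x + i / k)) k
      rw [Finset.sum_range_succ, div_self hk', hB] at h1
      have h2 : ∀ i : ℕ, x + 1 / k + i / k = x + ((i + 1 : ℕ) : ℚ) / k := fun i => by
        push_cast; ring
      simp only [h2]
      simp only [Nat.cast_zero, zero_div, add_zero] at h1
      linear_combination -h1
    have e2 : (k : ℚ) * (x + 1 / k) = k * x + 1 := by field_simp
    have e3 : (k : ℚ) ^ n * (n * x ^ (n - 1)) = k * (n * (k * x) ^ (n - 1)) := by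
      rcases n with _ | n
      · simp
      · simp only [Nat.add_sub_cancel]; ring
    simp only [hP, eval_sub, eval_mul, eval_C, eval_finsetSum, eval_comp, eval_add, eval_X]
    rw [e1, e2, hB]
    linear_combination e3
  have hder : ∀ n, derivative (P (n + 1)) = C ((k : ℚ) * (n + 1)) * P n := by
    intro n
    simp only [hP, derivative_sub, derivative_mul, derivative_C, zero_mul, zero_add,
      derivative_sum, derivative_comp, derivative_add, derivative_X, add_zero, one_mul, mul_one,
      Polynomial.derivative_bernoulli_add_one, mul_comp, add_comp, one_comp, natCast_comp]
    rw [← Finset.mul_sum]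
    simp only [map_mul, map_add, map_pow, map_one, map_natCast]
    ring
  have h0 : P n = 0 := by
    have h1 := derivative_eq_zero_of_periodic (one_div_ne_zero hk') (hper (n + 1))
    rw [hder] at h1
    refine (mul_eq_zero.1 h1).resolve_left fun h2 => ?_
    rw [C_eq_zero] at h2
    exact mul_ne_zero hk' (by positivity) h2
  rw [hP] at h0
  exact sub_eq_zero.1 h0

theorem periodic_add_mul {M : Type*} {ψ : ℕ → M} {F : ℕ} (hψ : ∀ a, ψ (a + F) = ψ a) (a i : ℕ) :
    ψ (a + i * F) = ψ a := by
  induction i with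
  | zero => simp
  | succ i ih => rw [← ih, ← hψ (a + i * F)]; congr 1; ring

theorem sum_Icc_mul {M : Type*} [AddCommMonoid M] (g : ℕ → M) (F m : ℕ) :
    ∑ a ∈ Finset.Icc 1 (F * m), g a =
      ∑ a ∈ Finset.Icc 1 F, ∑ i ∈ Finset.range m, g (a + i * F) := by
  have hIcc : ∀ (h : ℕ → M) (n : ℕ), ∑ a ∈ Finset.Icc 1 n, h a = ∑ a ∈ Finset.range n, h (a + 1) :=
    fun h n => by
      rw [Finset.range_eq_Ico, Finset.sum_Ico_add', zero_add]
      rfl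
  rw [Finset.sum_comm, hIcc]
  induction m with
  | zero => simp
  | succ m ih =>
    rw [Finset.sum_range_succ, ← ih, Nat.mul_succ, Finset.sum_range_add, hIcc]
    congr 1
    exact Finset.sum_congr rfl fun a _ => by congr 1; ring

theorem sum_Icc_neg_one_pow {K : Type*} [CommRing K] (g : ℕ → K) (F : ℕ) :
    ∑ a ∈ Finset.Icc 1 (F * 2), (-1) ^ a * g a =
      2 * ∑ b ∈ Finset.Icc 1 F, g (2 * b) - ∑ a ∈ Finset.Icc 1 (F * 2), g a := by
  induction F with
  | zero => simp
  | succ F ih =>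
    rw [show (F + 1) * 2 = F * 2 + 1 + 1 by ring, Finset.sum_Icc_succ_top (by omega),
      Finset.sum_Icc_succ_top (by omega), ih, Finset.sum_Icc_succ_top (by omega),
      Finset.sum_Icc_succ_top (b := F * 2 + 1) (by omega), Finset.sum_Icc_succ_top (by omega),
      show 2 * (F + 1) = F * 2 + 1 + 1 by ring, mul_comm F 2]
    have e1 : (-1 : K) ^ (2 * F + 1) = -1 := by rw [pow_succ, pow_mul]; simp
    have e2 : (-1 : K) ^ (2 * F + 1 + 1) = 1 := by rw [pow_succ, e1]; ring
    rw [e1, e2]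
    ring

variable {K : Type*} [Field K] [CharZero K]

theorem sum_aeval_bernoulli_add_div (k n : ℕ) (hk : k ≠ 0) (x : K) :
    (k : K) ^ n * ∑ i ∈ Finset.range k,
      Polynomial.aeval (x + (i : K) / k) (Polynomial.bernoulli (n + 1)) =
      Polynomial.aeval (k * x) (Polynomial.bernoulli (n + 1)) := by
  have h := congrArg (Polynomial.aeval x) (sum_bernoulli_comp k (n + 1) hk)
  have hk' : (k : K) ≠ 0 := by exact_mod_cast hk
  simp only [map_mul, map_sum, Polynomial.aeval_comp, map_add, Polynomial.aeval_X,
    Polynomial.aeval_C, map_pow, map_natCast, map_div₀, pow_succ] at h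
  exact mul_left_cancel₀ hk' (by rw [← h]; ring)

/-- The sum `F ^ (n-1) ∑_{a=1}^F ψ(a) B_n(a/F)`, which for `ψ` of period `F` is the generalized
Bernoulli number of `ψ`. -/
noncomputable def bernoulliSum (F : ℕ) (ψ : ℕ → K) (n : ℕ) : K :=
  (F : K) ^ (n - 1) * ∑ a ∈ Finset.Icc 1 F,
    ψ a * Polynomial.aeval ((a : K) / (F : K)) (Polynomial.bernoulli n)

/-- The generalized Bernoulli number does not depend on the period used to compute it. -/
theorem bernoulliSum_mul {F : ℕ} (hF : F ≠ 0) {ψ : ℕ → K} (hψ : ∀ a, ψ (a + F) = ψ a) {k : ℕ}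
    (hk : k ≠ 0) (n : ℕ) : bernoulliSum (F * k) ψ (n + 1) = bernoulliSum F ψ (n + 1) := by
  have hF' : (F : K) ≠ 0 := by exact_mod_cast hF
  have hk' : (k : K) ≠ 0 := by exact_mod_cast hk
  rw [bernoulliSum, bernoulliSum, sum_Icc_mul, Nat.add_sub_cancel, Nat.cast_mul, mul_pow, mul_assoc,
    Finset.mul_sum]
  congr 1
  refine Finset.sum_congr rfl fun a _ => ?_
  have h := sum_aeval_bernoulli_add_div k n hk ((a : K) / (F * k))
  rw [show (k : K) * (a / (F * k)) = a / F by field_simp] at h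
  rw [← h, mul_left_comm (ψ a), Finset.mul_sum _ _ (ψ a)]
  congr 1
  refine Finset.sum_congr rfl fun i _ => ?_
  rw [periodic_add_mul hψ]
  congr 3
  push_cast
  field_simp

/-- The value at `x` of the `n`-th Euler polynomial, expressed through Bernoulli polynomials. -/
noncomputable def eulerValue (n : ℕ) (x : K) : K :=
  2 ^ (n + 1) / (n + 1) * (Polynomial.aeval ((x + 1) / 2) (Polynomial.bernoulli (n + 1)) -
    Polynomial.aeval (x / 2) (Polynomial.bernoulli (n + 1)))

theorem eulerValue_add_one (n : ℕ) (x : K) :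
    eulerValue n (x + 1) + eulerValue n x = 2 * x ^ n := by
  have h := aeval_bernoulli_add_one (n + 1) (x / 2)
  have hn : (n : K) + 1 ≠ 0 := by exact_mod_cast n.succ_ne_zero
  rw [Nat.add_sub_cancel, show x / 2 + 1 = (x + 1 + 1) / 2 by ring] at h
  rw [eulerValue, eulerValue, h, div_pow]
  push_cast
  field_simp
  ring

theorem sum_neg_one_pow_mul_add_pow (n m : ℕ) (x : K) :
    ∑ i ∈ Finset.range m, (-1) ^ i * (x + i) ^ n =
      (eulerValue n x - (-1) ^ m * eulerValue n (x + m)) / 2 := by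
  induction m with
  | zero => simp
  | succ m ih =>
    have h := eulerValue_add_one n (x + m)
    rw [Finset.sum_range_succ, ih]
    push_cast
    rw [← add_assoc, pow_succ]
    linear_combination (-(-1) ^ m / 2) * h

/-- Alternating power sums weighted by a function of odd period. -/
theorem sum_neg_one_pow_mul_periodic {F m : ℕ} (hF : Odd F) (hm : Odd m) {ψ : ℕ → K}
    (hψ : ∀ a, ψ (a + F) = ψ a) (n : ℕ) :
    ∑ a ∈ Finset.Icc 1 (F * m), (-1) ^ (a + 1) * (ψ a * (a : K) ^ n) =
      (F : K) ^ n * ∑ a ∈ Finset.Icc 1 F, (-1) ^ (a + 1) * ψ a *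
        ((eulerValue n ((a : K) / F) + eulerValue n ((a : K) / F + m)) / 2) := by
  have hF' : (F : K) ≠ 0 := by exact_mod_cast hF.pos.ne'
  rw [sum_Icc_mul, Finset.mul_sum]
  refine Finset.sum_congr rfl fun a _ => ?_
  have h := sum_neg_one_pow_mul_add_pow n m ((a : K) / F)
  rw [hm.neg_one_pow, neg_one_mul, sub_neg_eq_add] at h
  rw [← h, Finset.mul_sum, Finset.mul_sum]
  refine Finset.sum_congr rfl fun i _ => ?_
  have e : (-1 : K) ^ (a + i * F + 1) = (-1) ^ (a + 1) * (-1) ^ i := by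
    rw [show a + i * F + 1 = (a + 1) + i * F by ring, pow_add, mul_comm i F, pow_mul,
      hF.neg_one_pow]
  have e2 : ((a + i * F : ℕ) : K) = F * (a / F + i) := by
    push_cast
    field_simp
  rw [periodic_add_mul hψ, e, e2, mul_pow]
  ring

/-- The weighted sum of Euler polynomial values in terms of generalized Bernoulli numbers. -/
theorem sum_eulerValue {F : ℕ} (hF : Odd F) {ψ : ℕ → K} (hψ : ∀ a, ψ (a + F) = ψ a)
    (h2 : ∀ a, ψ (2 * a) = ψ 2 * ψ a) (n : ℕ) :
    (F : K) ^ n * ∑ a ∈ Finset.Icc 1 F, (-1) ^ (a + 1) * ψ a * eulerValue n ((a : K) / F) =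
      -(2 * (1 - ψ 2 * 2 ^ (n + 1)) * bernoulliSum F ψ (n + 1) / (n + 1)) := by
  have hF' : (F : K) ≠ 0 := by exact_mod_cast hF.pos.ne'
  have hn : (n : K) + 1 ≠ 0 := by exact_mod_cast n.succ_ne_zero
  have hd := bernoulliSum_mul hF.pos.ne' hψ two_ne_zero n
  obtain ⟨g, hg⟩ : ∃ g : ℕ → K, ∀ a, g a = ψ a * Polynomial.aeval ((a : K) / (F * 2 : ℕ))
    (Polynomial.bernoulli (n + 1)) := ⟨_, fun _ => rfl⟩
  have h1 : ∑ a ∈ Finset.Icc 1 F, (-1) ^ (a + 1) * ψ a * eulerValue n ((a : K) / F) =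
      2 ^ (n + 1) / (n + 1) * ∑ a ∈ Finset.Icc 1 (F * 2), (-1) ^ a * g a := by
    rw [sum_Icc_mul, Finset.mul_sum]
    refine Finset.sum_congr rfl fun a _ => ?_
    rw [Finset.sum_range_succ, Finset.sum_range_one, hg, hg, periodic_add_mul hψ,
      periodic_add_mul hψ, zero_mul, add_zero, one_mul, pow_add _ a F, hF.neg_one_pow, eulerValue,
      show (((a + F : ℕ) : K) / (F * 2 : ℕ)) = (a / F + 1) / 2 by push_cast; field_simp,
      show ((a : K) / (F * 2 : ℕ)) = a / F / 2 by push_cast; field_simp]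
    ring
  have h3 : ∑ b ∈ Finset.Icc 1 F, g (2 * b) = ψ 2 * ∑ b ∈ Finset.Icc 1 F,
      ψ b * Polynomial.aeval ((b : K) / F) (Polynomial.bernoulli (n + 1)) := by
    rw [Finset.mul_sum]
    refine Finset.sum_congr rfl fun b _ => ?_
    rw [hg, h2, show (((2 * b : ℕ) : K) / (F * 2 : ℕ)) = b / F by push_cast; field_simp]
    ring
  rw [bernoulliSum, Nat.add_sub_cancel] at hd
  simp only [← hg] at hd
  rw [h1, sum_Icc_neg_one_pow, h3]
  rw [bernoulliSum, Nat.add_sub_cancel] at hd ⊢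
  obtain ⟨S, hS⟩ : ∃ S : K, S = ∑ b ∈ Finset.Icc 1 F,
      ψ b * Polynomial.aeval ((b : K) / F) (Polynomial.bernoulli (n + 1)) := ⟨_, rfl⟩
  obtain ⟨T, hT⟩ : ∃ T : K, T = ∑ a ∈ Finset.Icc 1 (F * 2), g a := ⟨_, rfl⟩
  rw [← hS, ← hT] at hd ⊢
  push_cast at hd
  rw [mul_pow] at hd
  linear_combination (-2 / ((n : K) + 1)) * hd

end Bernoulli

section PadicBernoulli

variable {p : ℕ} [Fact p.Prime]

theorem continuous_eulerValue (n : ℕ) : Continuous (eulerValue n : ℂ_[p] → ℂ_[p]) := by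
  unfold eulerValue
  simp only [Polynomial.aeval_def, ← Polynomial.eval_map]
  fun_prop

theorem tendsto_prime_pow : Tendsto (fun n : ℕ => ((p ^ n : ℕ) : ℂ_[p])) atTop (𝓝 0) := by
  simp only [Nat.cast_pow]
  refine tendsto_pow_atTop_nhds_zero_of_norm_lt_one ?_
  rw [norm_natCast_self]
  exact inv_lt_one_of_one_lt₀ one_lt_prime

/-- The `p`-adic limit of alternating power sums weighted by a function of odd period. -/
theorem tendsto_alternating_sum (hp : p ≠ 2) {F : ℕ} (hF : Odd F) {ψ : ℕ → ℂ_[p]}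
    (hψ : ∀ a, ψ (a + F) = ψ a) (h2 : ∀ a, ψ (2 * a) = ψ 2 * ψ a) (n : ℕ) :
    Tendsto (fun m : ℕ => 1 / 2 * ∑ a ∈ Finset.Icc 1 (F * p ^ m),
        (-1) ^ (a + 1) * (ψ a * (a : ℂ_[p]) ^ n)) atTop
      (𝓝 (-((1 - ψ 2 * 2 ^ (n + 1)) * bernoulliSum F ψ (n + 1) / (n + 1)))) := by
  have hpo : Odd p := (Fact.out : p.Prime).odd_of_ne_two hp
  have h : -((1 - ψ 2 * 2 ^ (n + 1)) * bernoulliSum F ψ (n + 1) / (n + 1)) =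
      1 / 2 * ((F : ℂ_[p]) ^ n * ∑ a ∈ Finset.Icc 1 F, (-1) ^ (a + 1) * ψ a *
        ((eulerValue n ((a : ℂ_[p]) / F) + eulerValue n ((a : ℂ_[p]) / F + 0)) / 2)) := by
    simp only [add_zero, add_self_div_two]
    rw [sum_eulerValue hF hψ h2]
    ring
  rw [h]
  simp only [fun m => sum_neg_one_pow_mul_periodic (K := ℂ_[p]) hF (hpo.pow (n := m)) hψ n]
  refine Tendsto.const_mul _ (Tendsto.const_mul _ (tendsto_finsetSum _ fun a _ => ?_))
  refine Tendsto.const_mul _ (Tendsto.div_const (Tendsto.const_add _ ?_) _)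
  exact ((continuous_eulerValue n).tendsto _).comp (tendsto_const_nhds.add tendsto_prime_pow)

/-- Bernoulli numbers have at most a simple pole at `p`, by the von Staudt-Clausen theorem. -/
theorem norm_bernoulli_le (hp : p ≠ 2) (j : ℕ) : ‖((bernoulli j : ℚ) : ℂ_[p])‖ ≤ p := by
  have hp1 : (1 : ℝ) ≤ p := one_lt_prime.le
  rcases Nat.even_or_odd' j with ⟨k, rfl | rfl⟩
  · obtain ⟨z, hz⟩ := Bernoulli.vonStaudt_clausen k
    rw [eq_sub_of_add_eq hz.symm, Rat.cast_sub, Rat.cast_intCast, Rat.cast_sum,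
      sub_eq_add_neg]
    refine (IsUltrametricDist.norm_add_le_max _ _).trans (max_le ?_ ?_)
    · exact (IsUltrametricDist.norm_intCast_le_one _ _).trans hp1
    · rw [norm_neg]
      refine IsUltrametricDist.norm_sum_le_of_forall_le_of_nonneg (by positivity) fun q hq => ?_
      have hqp : q.Prime := (Finset.mem_filter.1 hq).2.1
      rw [Rat.cast_div, Rat.cast_one, Rat.cast_natCast, norm_div, norm_one]
      rcases eq_or_ne q p with rfl | hne
      · rw [norm_natCast_self, one_div, inv_inv]
      · rw [norm_natCast_eq_one fun h => hne ((Nat.prime_dvd_prime_iff_eq Fact.out hqp).1 h).symm,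
          div_one]
        exact hp1
  · rcases Nat.eq_zero_or_pos k with rfl | hk
    · have h2 : ‖((2 : ℕ) : ℂ_[p])‖ = 1 := norm_natCast_eq_one fun h =>
        hp ((Nat.prime_dvd_prime_iff_eq Fact.out Nat.prime_two).1 h)
      rw [Nat.cast_ofNat] at h2
      rw [mul_zero, zero_add, bernoulli_one, Rat.cast_div, Rat.cast_neg, Rat.cast_one,
        Rat.cast_ofNat, norm_div, norm_neg, norm_one, h2, div_one]
      exact hp1
    · rw [bernoulli_eq_zero_of_odd ⟨k, rfl⟩ (by omega), Rat.cast_zero, norm_zero]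
      positivity

/-- The homogeneous form of the expansion of a Bernoulli polynomial. -/
theorem sum_choose_mul_bernoulli {K : Type*} [Field K] [CharZero K] {x : K} (hx : x ≠ 0) (n : ℕ) :
    x ^ n * ∑ j ∈ Finset.range (n + 1), (n.choose j : K) * ((x⁻¹) ^ j * (bernoulli j : ℚ)) =
      Polynomial.aeval x (Polynomial.bernoulli n) := by
  rw [Polynomial.bernoulli, map_sum, Finset.mul_sum]
  refine Finset.sum_congr rfl fun j hj => ?_
  have hj' : j ≤ n := by have := Finset.mem_range.1 hj; omega
  rw [Polynomial.aeval_monomial, ← Nat.sub_add_cancel hj', pow_add, Nat.sub_add_cancel hj', map_mul,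
    map_natCast, eq_ratCast, inv_pow]
  field_simp

end PadicBernoulli

/-! ### The Teichmüller character and the twists `χ ω⁻ⁿ` -/

section Teichmuller

variable {p : ℕ} [Fact p.Prime]

theorem norm_natCast_two (hp : p ≠ 2) : ‖(2 : ℂ_[p])‖ = 1 := by
  have := norm_natCast_eq_one (p := p) (n := 2) fun h =>
    hp ((Nat.prime_dvd_prime_iff_eq Fact.out Nat.prime_two).1 h)
  rwa [Nat.cast_ofNat] at this

theorem natCast_zmod_ne_zero {a : ℕ} (ha : ¬ p ∣ a) : (a : ZMod p) ≠ 0 :=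
  fun h => ha ((ZMod.natCast_eq_zero_iff a p).1 h)

theorem teich_natCast_eq_zero {a : ℕ} (ha : p ∣ a) : teich p (a : ZMod p) = 0 := by
  rw [(ZMod.natCast_eq_zero_iff a p).2 ha]
  exact MulChar.map_zero _

theorem teich_pow_sub_one {a : ZMod p} (ha : a ≠ 0) : teich p a ^ (p - 1) = 1 := by
  rw [← map_pow, ZMod.pow_card_sub_one_eq_one ha, map_one]

theorem teich_ne_zero {a : ZMod p} (ha : a ≠ 0) : teich p a ≠ 0 := fun h => by
  have h1 := teich_pow_sub_one ha
  rw [h, zero_pow (Nat.sub_pos_of_lt (Fact.out : p.Prime).one_lt).ne'] at h1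
  exact zero_ne_one h1

theorem norm_teich {a : ZMod p} (ha : a ≠ 0) : ‖teich p a‖ = 1 := by
  refine (pow_eq_one_iff_of_nonneg (norm_nonneg _)
    (Nat.sub_pos_of_lt (Fact.out : p.Prime).one_lt).ne').1 ?_
  rw [← norm_pow, teich_pow_sub_one ha, norm_one]

theorem norm_algebraMap_padicInt (x : ℤ_[p]) :
    ‖algebraMap ℚ_[p] ℂ_[p] (x : ℚ_[p])‖ = ‖x‖ := by
  rw [norm_algebraMap']
  rfl

theorem toZMod_eq_zero_iff (x : ℤ_[p]) : PadicInt.toZMod x = 0 ↔ ‖x‖ < 1 := by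
  rw [← RingHom.mem_ker, PadicInt.ker_toZMod, IsLocalRing.mem_maximalIdeal, mem_nonunits_iff,
    PadicInt.isUnit_iff]
  exact ⟨fun h => lt_of_le_of_ne (PadicInt.norm_le_one x) h, fun h => h.ne⟩

theorem norm_natCast_sub_teich_le (a : ℕ) :
    ‖(a : ℂ_[p]) - teich p (a : ZMod p)‖ ≤ (p : ℝ)⁻¹ := by
  have h1 : (a : ℂ_[p]) - teich p (a : ZMod p) =
      algebraMap ℚ_[p] ℂ_[p] (((a : ℤ_[p]) - teichLift p (a : ZMod p) : ℤ_[p]) : ℚ_[p]) := by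
    rw [PadicInt.coe_sub, map_sub, PadicInt.coe_natCast,
      map_natCast (algebraMap ℚ_[p] ℂ_[p])]
    rfl
  have h2 : ‖(a : ℤ_[p]) - teichLift p (a : ZMod p)‖ < 1 := by
    rw [← toZMod_eq_zero_iff, map_sub, map_natCast, toZMod_teichLift, sub_self]
  rw [h1, norm_algebraMap_padicInt]
  have := (PadicInt.norm_le_pow_iff_norm_lt_pow_add_one
    ((a : ℤ_[p]) - teichLift p (a : ZMod p)) (-1)).2 (by simpa using h2)
  simpa using this

/-- Distinct Teichmüller representatives are incongruent. -/
theorem norm_teich_sub_one {a : ZMod p} (ha : a ≠ 1) : ‖teich p a - 1‖ = 1 := by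
  have h1 : teich p a - 1 = algebraMap ℚ_[p] ℂ_[p] ((teichLift p a - 1 : ℤ_[p]) : ℚ_[p]) := by
    rw [PadicInt.coe_sub, map_sub, PadicInt.coe_one, map_one]
    rfl
  rw [h1, norm_algebraMap_padicInt]
  refine le_antisymm (PadicInt.norm_le_one _) (not_lt.1 fun h => ha ?_)
  rwa [← toZMod_eq_zero_iff, map_sub, toZMod_teichLift, map_one, sub_eq_zero] at h

theorem norm_angle_sub_one_le {a : ℕ} (ha : ¬ p ∣ a) :
    ‖(angle a : ℂ_[p]) - 1‖ ≤ (p : ℝ)⁻¹ := by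
  have h0 := natCast_zmod_ne_zero ha
  have h1 : (angle a : ℂ_[p]) - 1 =
      (teich p (a : ZMod p))⁻¹ * ((a : ℂ_[p]) - teich p (a : ZMod p)) := by
    rw [angle, mul_sub, inv_mul_cancel₀ (teich_ne_zero h0)]
  rw [h1, norm_mul, norm_inv, norm_teich h0, inv_one, one_mul]
  exact norm_natCast_sub_teich_le a

end Teichmuller

section TwistedCharacter

theorem lcm_dvd_mul (f p : ℕ) : f.lcm p ∣ f * p :=
  Nat.lcm_dvd (Dvd.intro _ rfl) (Dvd.intro_left _ rfl)

theorem sum_Icc_mul_eq_add {M : Type*} [AddCommMonoid M] {p : ℕ} (hp : 0 < p) (g : ℕ → M) (m : ℕ) :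
    ∑ a ∈ Finset.Icc 1 (p * m), g a =
      ∑ a ∈ (Finset.Icc 1 (p * m)).filter (fun a => ¬ p ∣ a), g a +
        ∑ b ∈ Finset.Icc 1 m, g (p * b) := by
  rw [← Finset.sum_filter_add_sum_filter_not _ (fun a => ¬ p ∣ a)]
  congr 1
  symm
  refine Finset.sum_nbij (fun b => p * b) ?_ ?_ ?_ (fun _ _ => rfl)
  · intro b hb
    obtain ⟨h1, h2⟩ := Finset.mem_Icc.1 hb
    simp only [Finset.mem_filter, Finset.mem_Icc, not_not]
    exact ⟨⟨Nat.mul_pos hp h1, Nat.mul_le_mul_left p h2⟩, dvd_mul_right _ _⟩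
  · intro b _ c _ h
    exact Nat.eq_of_mul_eq_mul_left hp h
  · intro a ha
    simp only [Finset.coe_filter, Finset.mem_Icc, not_not, Set.mem_ofPred_eq] at ha
    obtain ⟨⟨h1, h2⟩, b, rfl⟩ := ha
    refine ⟨b, ?_, rfl⟩
    rw [Finset.coe_Icc, Set.mem_Icc]
    exact ⟨Nat.pos_of_mul_pos_left h1, Nat.le_of_mul_le_mul_left h2 hp⟩

variable {p : ℕ} [Fact p.Prime] {f : ℕ}

/-- The function `a ↦ χ(a) ω(a)⁻ⁿ`. For `n ≥ 1` it vanishes at the multiples `a` of `p`, because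
`ω(a) = 0` there and `0⁻¹ = 0`. -/
noncomputable def twistFun (χ : DirichletCharacter ℂ_[p] f) (n a : ℕ) : ℂ_[p] :=
  χ (a : ZMod f) * ((teich p (a : ZMod p))⁻¹) ^ n

theorem twistFun_mul (χ : DirichletCharacter ℂ_[p] f) (n a b : ℕ) :
    twistFun χ n (a * b) = twistFun χ n a * twistFun χ n b := by
  simp only [twistFun, Nat.cast_mul, map_mul, mul_inv, mul_pow]
  ring

theorem twistFun_add (χ : DirichletCharacter ℂ_[p] f) (n a : ℕ) :
    twistFun χ n (a + f * p) = twistFun χ n a := by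
  simp [twistFun]

theorem twistFun_eq_zero (χ : DirichletCharacter ℂ_[p] f) {n a : ℕ} (hn : n ≠ 0) (ha : p ∣ a) :
    twistFun χ n a = 0 := by
  rw [twistFun, teich_natCast_eq_zero ha, inv_zero, zero_pow hn, mul_zero]

theorem twistFun_mul_pow (χ : DirichletCharacter ℂ_[p] f) (n a : ℕ) :
    twistFun χ n a * (a : ℂ_[p]) ^ n = χ (a : ZMod f) * angle a ^ n := by
  rw [twistFun, angle, mul_pow]
  ring

theorem twistFun_succ_mul_pow (χ : DirichletCharacter ℂ_[p] f) (n a : ℕ) :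
    twistFun χ (n + 1) a * (a : ℂ_[p]) ^ n = twistFun χ 1 a * angle a ^ n := by
  rw [twistFun, twistFun, angle, mul_pow]
  ring

theorem norm_twistFun_le (χ : DirichletCharacter ℂ_[p] f) (n a : ℕ) : ‖twistFun χ n a‖ ≤ 1 := by
  rw [twistFun, norm_mul, norm_pow, norm_inv]
  refine mul_le_one₀ (DirichletCharacter.norm_le_one χ _) (by positivity)
    (pow_le_one₀ (by positivity) ?_)
  by_cases h : (a : ZMod p) = 0
  · rw [h, MulChar.map_zero, norm_zero, inv_zero]; exact zero_le_one
  · rw [norm_teich h, inv_one]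

/-- All prime factors of the modulus of `χ`, with the possible exception of `p`, divide the
conductor of `χ`: this holds for primitive characters and for all characters modulo `p`. -/
def PrimitiveAwayFrom (χ : DirichletCharacter ℂ_[p] f) : Prop :=
  ∀ l : ℕ, l.Prime → l ∣ f → l ≠ p → l ∣ χ.conductor

theorem twist_natCast_of_coprime (χ : DirichletCharacter ℂ_[p] f) (n : ℕ) {a : ℕ}
    (ha : a.Coprime (f.lcm p)) : twist χ n (a : ZMod _) = twistFun χ n a := by
  have h1 : IsCoprime (a : ℤ) (f.lcm p : ℕ) := Nat.isCoprime_iff_coprime.2 ha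
  have h2 := DirichletCharacter.primitiveCharacter_apply_of_isCoprime (χ.mul (teich p ^ n)⁻¹) h1
  have h3 := χ.changeLevel_eq_cast_of_dvd' (Nat.dvd_lcm_left f p) h1
  have h4 := ((teich p ^ n)⁻¹).changeLevel_eq_cast_of_dvd' (Nat.dvd_lcm_right f p) h1
  rw [twist, DirichletCharacter.primitive_mul]
  simp only [Int.cast_natCast] at h2 h3 h4
  have hap : IsUnit (a : ZMod p) :=
    (ZMod.isUnit_iff_coprime a p).2 (ha.coprime_dvd_right (Nat.dvd_lcm_right f p))
  rw [h2, DirichletCharacter.mul, MulChar.mul_apply, h3, h4, MulChar.inv_apply_eq_inv', twistFun,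
    inv_pow]
  congr 2
  exact MulChar.pow_apply_coe (teich p) n hap.unit

variable [NeZero f] {χ : DirichletCharacter ℂ_[p] f}

/-- Outside the multiples of `p`, the primitive character `χ ω⁻ⁿ` is given by `χ(a) ω(a)⁻ⁿ`, also
at integers not prime to the modulus: a prime factor `l ≠ p` of the conductor of `χ` divides the
conductor of `χ ω⁻ⁿ`, because `χ` is the product of `χ ω⁻ⁿ` and a character modulo `p`. -/
theorem twist_natCast (hχ : PrimitiveAwayFrom χ) (n : ℕ) {a : ℕ} (ha : ¬ p ∣ a) :
    twist χ n (a : ZMod _) = twistFun χ n a := by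
  have hpp : p.Prime := Fact.out
  by_cases hc : a.Coprime (f.lcm p)
  · exact twist_natCast_of_coprime χ n hc
  obtain ⟨l, hl, hla, hlm⟩ := Nat.Prime.not_coprime_iff_dvd.1 hc
  have hlp : l ≠ p := fun h => ha (h ▸ hla)
  have hlp' : ¬ l ∣ p := fun h => hlp ((Nat.prime_dvd_prime_iff_eq hl hpp).1 h)
  have hlf : l ∣ f := ((hl.dvd_mul).1 (hlm.trans (lcm_dvd_mul f p))).resolve_right hlp'
  have hm : NeZero (f.lcm p) := ⟨Nat.lcm_ne_zero (NeZero.ne f) hpp.ne_zero⟩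
  have h0 : χ (a : ZMod f) = 0 := by
    refine MulChar.map_nonunit _ fun hu => ?_
    exact Nat.Prime.not_coprime_iff_dvd.2 ⟨l, hl, hla, hlf⟩ ((ZMod.isUnit_iff_coprime a f).1 hu)
  have hfac : DirichletCharacter.changeLevel (Nat.dvd_lcm_left f p) χ =
      χ.mul (teich p ^ n)⁻¹ *
        DirichletCharacter.changeLevel (Nat.dvd_lcm_right f p) (teich p ^ n) := by
    rw [DirichletCharacter.mul, map_inv, inv_mul_cancel_right]
  have hdvd := DirichletCharacter.conductor_mul_dvd_lcm_conductor (χ.mul (teich p ^ n)⁻¹)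
    (DirichletCharacter.changeLevel (Nat.dvd_lcm_right f p) (teich p ^ n))
  rw [← hfac, DirichletCharacter.conductor_changeLevel,
    DirichletCharacter.conductor_changeLevel] at hdvd
  have h1 := ((hχ l hl hlf hlp).trans hdvd).trans (lcm_dvd_mul _ _)
  have h2 : l ∣ (χ.mul (teich p ^ n)⁻¹).conductor :=
    ((hl.dvd_mul).1 h1).resolve_right fun h =>
      hlp' (h.trans (DirichletCharacter.conductor_dvd_level _))
  rw [twistFun, h0, zero_mul]
  refine MulChar.map_nonunit _ fun hu => ?_
  exact Nat.Prime.not_coprime_iff_dvd.2 ⟨l, hl, hla, h2⟩ ((ZMod.isUnit_iff_coprime a _).1 hu)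

/-- Removing the Euler factor at `p` from the generalized Bernoulli number of `χ ω⁻ⁿ` amounts to
dropping the multiples of `p` from the sum defining it. -/
theorem bernoulliSum_twistFun (hχ : PrimitiveAwayFrom χ) (n : ℕ) :
    bernoulliSum (f * p) (twistFun χ (n + 1)) (n + 1) =
      (1 - twist χ (n + 1) (p : ZMod _) * (p : ℂ_[p]) ^ n) *
        genBernoulli (twist χ (n + 1)) (n + 1) := by
  have hpp : p.Prime := Fact.out
  have hp0 : (p : ℂ_[p]) ≠ 0 := by exact_mod_cast hpp.ne_zero
  have hf0 : (f : ℂ_[p]) ≠ 0 := by exact_mod_cast NeZero.ne f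
  have hm : NeZero (f.lcm p) := ⟨Nat.lcm_ne_zero (NeZero.ne f) hpp.ne_zero⟩
  obtain ⟨τ, hτ⟩ : ∃ τ : ℕ → ℂ_[p], ∀ a, τ a = twist χ (n + 1) (a : ZMod _) := ⟨_, fun _ => rfl⟩
  have hτper : ∀ a, τ (a + (χ.mul (teich p ^ (n + 1))⁻¹).conductor) = τ a := fun a => by
    rw [hτ, hτ, Nat.cast_add, ZMod.natCast_self, add_zero]
  have hτmul : ∀ a b, τ (a * b) = τ a * τ b := fun a b => by
    rw [hτ, hτ, hτ, Nat.cast_mul, map_mul]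
  have hgen : bernoulliSum (f * p) τ (n + 1) = genBernoulli (twist χ (n + 1)) (n + 1) := by
    obtain ⟨k, hk⟩ := ((χ.mul (teich p ^ (n + 1))⁻¹).conductor_dvd_level).trans (lcm_dvd_mul f p)
    have hc0 := DirichletCharacter.conductor_ne_zero (χ.mul (teich p ^ (n + 1))⁻¹)
    have hk0 : k ≠ 0 := fun h => by
      rw [h, mul_zero] at hk
      exact mul_ne_zero (NeZero.ne f) hpp.ne_zero hk
    rw [hk, bernoulliSum_mul hc0 hτper hk0, bernoulliSum, genBernoulli]
    simp only [hτ]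
  have hτper' : ∀ a, τ (a + f * p) = τ a := fun a => by
    obtain ⟨k, hk⟩ := ((χ.mul (teich p ^ (n + 1))⁻¹).conductor_dvd_level).trans (lcm_dvd_mul f p)
    rw [hk, mul_comm]
    exact periodic_add_mul hτper a k
  -- Both sums are taken over the period `f p²`, so that its quotient by `p` is still a multiple of
  -- the conductor of `χ ω⁻ⁿ`.
  have h1 := bernoulliSum_mul (mul_ne_zero (NeZero.ne f) hpp.ne_zero) hτper' hpp.ne_zero n
  have h2 := bernoulliSum_mul (mul_ne_zero (NeZero.ne f) hpp.ne_zero)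
    (twistFun_add χ (n + 1)) hpp.ne_zero n
  rw [← h2]
  rw [hgen] at h1
  rw [← hτ, sub_mul, one_mul, ← h1]
  nth_rewrite 2 [h1]
  rw [← hgen]
  simp only [bernoulliSum, Nat.add_sub_cancel]
  rw [mul_comm (f * p) p, sum_Icc_mul_eq_add hpp.pos, sum_Icc_mul_eq_add hpp.pos, mul_add, mul_add]
  have e1 : ∀ b : ℕ, twistFun χ (n + 1) (p * b) = 0 := fun b =>
    twistFun_eq_zero χ n.succ_ne_zero (dvd_mul_right _ _)
  have e2 : ∀ b : ℕ, ((p * b : ℕ) : ℂ_[p]) / (p * (f * p) : ℕ) = b / (f * p : ℕ) := fun b => by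
    push_cast
    field_simp
  have e3 : ∀ a ∈ (Finset.Icc 1 (p * (f * p))).filter (fun a => ¬ p ∣ a),
      twistFun χ (n + 1) a * Polynomial.aeval ((a : ℂ_[p]) / (p * (f * p) : ℕ))
        (Polynomial.bernoulli (n + 1)) =
      τ a * Polynomial.aeval ((a : ℂ_[p]) / (p * (f * p) : ℕ)) (Polynomial.bernoulli (n + 1)) :=
    fun a ha => by rw [hτ, twist_natCast hχ (n + 1) (Finset.mem_filter.1 ha).2]
  rw [Finset.sum_congr rfl e3]
  simp only [e1, e2, hτmul, zero_mul, Finset.sum_const_zero, mul_zero, add_zero, mul_assoc]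
  rw [← Finset.mul_sum]
  push_cast
  ring

end TwistedCharacter

/-! ### Existence of the `p`-adic `L`-function -/

section Existence

variable {p : ℕ} [Fact p.Prime] {f : ℕ}

theorem natDegree_one_sub_X_le : (1 - Polynomial.X : Polynomial ℤ).natDegree ≤ 1 := by
  compute_degree

theorem norm_bernoulli_term_le (hp : p ≠ 2) {a : ℕ} (ha : ¬ p ∣ a) (j : ℕ) :
    ‖(((f * p : ℕ) : ℂ_[p]) / a) ^ j * ((bernoulli j : ℚ) : ℂ_[p])‖ ≤ p / (p : ℝ) ^ j := by
  have h1 : ‖((f * p : ℕ) : ℂ_[p])‖ ≤ (p : ℝ)⁻¹ := by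
    rw [Nat.cast_mul, norm_mul, norm_natCast_self]
    exact mul_le_of_le_one_left (by positivity) (IsUltrametricDist.norm_natCast_le_one _ _)
  rw [norm_mul, norm_pow, norm_div, norm_natCast_eq_one ha, div_one, div_eq_inv_mul, ← inv_pow]
  exact mul_le_mul (pow_le_pow_left₀ (norm_nonneg _) h1 j) (norm_bernoulli_le hp j)
    (norm_nonneg _) (by positivity)

/-- The function `s ↦ x ^ (1 - s)` is a bounded power series. -/
theorem exists_isPowerSeriesOn_ppow_one_sub (hp : p ≠ 2) {x : ℂ_[p]} (hx : ‖x - 1‖ ≤ (p : ℝ)⁻¹) :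
    ∃ c : ℕ → ℂ_[p], HasBoundedCoeffs (radius p) c ∧
      IsPowerSeriesOn (radius p) c (fun s => ppow x (1 - s)) := by
  have h := exists_isPowerSeriesOn_choose hp natDegree_one_sub_X_le (norm_ppow_coeff_le hx)
  simp only [map_sub, map_one, Polynomial.aeval_X] at h
  exact h

theorem neg_one_sub_natCast (n : ℕ) : (1 : ℂ_[p]) - (n + 1 : ℕ) - 1 = -((n + 1 : ℕ) : ℂ_[p]) := by
  ring

/-- The series `1/F ∑ χ(a) ⟨a⟩^(1-s) ∑ⱼ (1-s choose j) (F/a)ʲ Bⱼ`, over the `a ≤ F` prime to `p` and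
with `F = f p`, which represents `(s - 1) L_p(s, χ)`. -/
noncomputable def bernoulliSeries (χ : DirichletCharacter ℂ_[p] f) (s : ℂ_[p]) : ℂ_[p] :=
  ((f * p : ℕ) : ℂ_[p])⁻¹ * ∑ a ∈ (Finset.Icc 1 (f * p)).filter (fun a => ¬ p ∣ a),
    χ (a : ZMod f) * (ppow (angle a) (1 - s) *
      ∑' j : ℕ, Ring.choose (1 - s) j *
        ((((f * p : ℕ) : ℂ_[p]) / a) ^ j * ((bernoulli j : ℚ) : ℂ_[p])))

theorem exists_isPowerSeriesOn_bernoulliSeries (hp : p ≠ 2) (χ : DirichletCharacter ℂ_[p] f) :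
    ∃ c : ℕ → ℂ_[p], HasBoundedCoeffs (radius p) c ∧
      IsPowerSeriesOn (radius p) c (bernoulliSeries χ) := by
  have hR0 : 0 ≤ radius p := (one_pos.trans (one_lt_radius hp)).le
  have key : ∀ a ∈ (Finset.Icc 1 (f * p)).filter (fun a => ¬ p ∣ a), ∃ c : ℕ → ℂ_[p],
      HasBoundedCoeffs (radius p) c ∧ IsPowerSeriesOn (radius p) c fun s =>
        χ (a : ZMod f) * (ppow (angle a) (1 - s) *
          ∑' j : ℕ, Ring.choose (1 - s) j *
            ((((f * p : ℕ) : ℂ_[p]) / a) ^ j * ((bernoulli j : ℚ) : ℂ_[p]))) := by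
    intro a ha
    have ha' := (Finset.mem_filter.1 ha).2
    obtain ⟨c, hc, hc'⟩ := exists_isPowerSeriesOn_ppow_one_sub hp (norm_angle_sub_one_le ha')
    have h2 := exists_isPowerSeriesOn_choose hp natDegree_one_sub_X_le
      (norm_bernoulli_term_le (f := f) hp ha')
    simp only [map_sub, map_one, Polynomial.aeval_X] at h2
    obtain ⟨d, hd, hd'⟩ := h2
    exact ⟨_, (hc.mul hR0 hd).const_mul _, (hc'.mul hd').const_mul _⟩
  choose! c hc hc' using key
  exact ⟨_, (HasBoundedCoeffs.sum hR0 _ hc).const_mul _, (IsPowerSeriesOn.sum _ hc').const_mul _⟩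

variable [NeZero f]


theorem sum_Icc_natCast {M : Type*} [AddCommMonoid M] (g : ZMod f → M) :
    ∑ a ∈ Finset.Icc 1 f, g (a : ZMod f) = ∑ x : ZMod f, g x := by
  refine Finset.sum_nbij' (fun a => (a : ZMod f)) (fun x => if x = 0 then f else x.val)
    (fun _ _ => Finset.mem_univ _) ?_ ?_ ?_ (fun _ _ => rfl)
  · intro x _
    split_ifs with h
    · exact Finset.mem_Icc.2 ⟨Nat.pos_of_ne_zero (NeZero.ne f), le_rfl⟩
    · exact Finset.mem_Icc.2 ⟨Nat.pos_of_ne_zero fun h0 => h ((ZMod.val_eq_zero x).1 h0),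
        (ZMod.val_lt x).le⟩
  · intro a ha
    obtain ⟨h1, h2⟩ := Finset.mem_Icc.1 ha
    rcases h2.lt_or_eq with h | rfl
    · rw [if_neg, ZMod.val_cast_of_lt h]
      intro h0
      exact absurd (Nat.le_of_dvd h1 ((ZMod.natCast_eq_zero_iff a f).1 h0)) (not_le.2 h)
    · simp
  · intro x _
    split_ifs with h
    · simp [h]
    · simp

/-- The values at the integers prime to `p` of a nontrivial character sum to zero over a period. -/
theorem sum_filter_eq_zero {χ : DirichletCharacter ℂ_[p] f} (hχ : χ ≠ 1) :
    ∑ a ∈ (Finset.Icc 1 (f * p)).filter (fun a => ¬ p ∣ a), χ (a : ZMod f) = 0 := by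
  have h0 : ∑ a ∈ Finset.Icc 1 f, χ (a : ZMod f) = 0 := by
    rw [sum_Icc_natCast (fun x => χ x)]
    exact MulChar.sum_eq_zero_of_ne_one hχ
  have h1 : ∑ a ∈ Finset.Icc 1 (f * p), χ (a : ZMod f) = 0 := by
    rw [sum_Icc_mul, Finset.sum_comm]
    refine Finset.sum_eq_zero fun i _ => ?_
    simpa using h0
  have h2 := sum_Icc_mul_eq_add (Fact.out : p.Prime).pos (fun a => χ (a : ZMod f)) f
  rw [mul_comm p f, h1] at h2
  simp only [Nat.cast_mul, map_mul] at h2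
  rw [← Finset.mul_sum, h0, mul_zero, add_zero] at h2
  exact h2.symm

theorem bernoulliSeries_one_sub (χ : DirichletCharacter ℂ_[p] f) (n : ℕ) :
    bernoulliSeries χ (1 - (n + 1 : ℕ)) =
      bernoulliSum (f * p) (twistFun χ (n + 1)) (n + 1) := by
  have hpp : p.Prime := Fact.out
  have hF : ((f * p : ℕ) : ℂ_[p]) ≠ 0 := by
    exact_mod_cast mul_ne_zero (NeZero.ne f) hpp.ne_zero
  have hsum : ∑ a ∈ Finset.Icc 1 (f * p), twistFun χ (n + 1) a *
        Polynomial.aeval ((a : ℂ_[p]) / (f * p : ℕ)) (Polynomial.bernoulli (n + 1)) =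
      ∑ a ∈ (Finset.Icc 1 (f * p)).filter (fun a => ¬ p ∣ a), twistFun χ (n + 1) a *
        Polynomial.aeval ((a : ℂ_[p]) / (f * p : ℕ)) (Polynomial.bernoulli (n + 1)) := by
    symm
    refine Finset.sum_filter_of_ne fun a _ h hdvd => h ?_
    rw [twistFun_eq_zero χ n.succ_ne_zero hdvd, zero_mul]
  rw [bernoulliSeries, bernoulliSum, Nat.add_sub_cancel, hsum, Finset.mul_sum, Finset.mul_sum]
  refine Finset.sum_congr rfl fun a ha => ?_
  have ha0 : (a : ℂ_[p]) ≠ 0 := by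
    have : a ≠ 0 := fun h => (Finset.mem_filter.1 ha).2 (h ▸ dvd_zero p)
    exact_mod_cast this
  have hx : (a : ℂ_[p]) / (f * p : ℕ) ≠ 0 := div_ne_zero ha0 hF
  have h1 : ∑' j : ℕ, Ring.choose ((n + 1 : ℕ) : ℂ_[p]) j *
        ((((f * p : ℕ) : ℂ_[p]) / a) ^ j * ((bernoulli j : ℚ) : ℂ_[p])) =
      ∑ j ∈ Finset.range (n + 1 + 1), ((n + 1).choose j : ℂ_[p]) *
        ((((f * p : ℕ) : ℂ_[p]) / a) ^ j * ((bernoulli j : ℚ) : ℂ_[p])) := by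
    rw [tsum_eq_sum (s := Finset.range (n + 1 + 1))]
    · exact Finset.sum_congr rfl fun j _ => by rw [Ring.choose_natCast]
    · intro j hj
      rw [Ring.choose_natCast, Nat.choose_eq_zero_of_lt (by simpa using hj), Nat.cast_zero,
        zero_mul]
  have h2 := sum_choose_mul_bernoulli hx (n + 1)
  rw [inv_div] at h2
  rw [sub_sub_cancel, ppow_natCast, h1, ← h2, ← mul_assoc (χ _), ← twistFun_mul_pow, div_pow,
    pow_succ (((f * p : ℕ) : ℂ_[p]))]
  field_simp

theorem bernoulliSeries_one {χ : DirichletCharacter ℂ_[p] f} (hχ : χ ≠ 1) :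
    bernoulliSeries χ 1 = 0 := by
  have h1 : ∀ x : ℕ → ℂ_[p], x 0 = 1 → ∑' j : ℕ, Ring.choose (0 : ℂ_[p]) j * x j = 1 := by
    intro x hx
    rw [tsum_eq_single 0]
    · rw [Ring.choose_zero_right, hx, one_mul]
    · intro j hj
      rw [Ring.choose_zero_pos _ (Nat.pos_of_ne_zero hj), zero_mul]
  rw [bernoulliSeries]
  simp only [sub_self, ppow_zero]
  rw [Finset.sum_congr rfl fun a _ => by rw [h1 _ (by simp), one_mul, mul_one],
    sum_filter_eq_zero hχ, mul_zero]

/-- Existence of the `p`-adic `L`-function, as the quotient of `bernoulliSeries χ` by `s - 1`. -/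
theorem exists_isPadicLFunction (hp : p ≠ 2) {χ : DirichletCharacter ℂ_[p] f}
    (hχ : PrimitiveAwayFrom χ) : ∃ L, IsPadicLFunction χ L := by
  have hR := one_lt_radius hp
  obtain ⟨c, hc, hc'⟩ := exists_isPowerSeriesOn_bernoulliSeries hp χ
  have hint : ∀ L : ℂ_[p] → ℂ_[p],
      (∀ n : ℕ, bernoulliSeries χ (1 - (n + 1 : ℕ)) =
        (1 - (n + 1 : ℕ) - 1) * L (1 - (n + 1 : ℕ))) →
      ∀ n : ℕ, 1 ≤ n → L (1 - (n : ℂ_[p])) =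
      -(1 - twist χ n (p : ZMod _) * (p : ℂ_[p]) ^ (n - 1)) * genBernoulli (twist χ n) n
        / (n : ℂ_[p]) := by
    intro L hL n hn
    obtain ⟨n, rfl⟩ := Nat.exists_eq_add_of_le' hn
    have hn0 : ((n + 1 : ℕ) : ℂ_[p]) ≠ 0 := by exact_mod_cast n.succ_ne_zero
    have h := hL n
    rw [bernoulliSeries_one_sub, bernoulliSum_twistFun hχ, neg_one_sub_natCast] at h
    rw [Nat.add_sub_cancel, eq_div_iff hn0]
    linear_combination h
  by_cases h1 : χ = 1
  · refine ⟨fun s => bernoulliSeries χ s / (s - 1), fun h => absurd h1 h, fun _ => ?_,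
      hint (fun s => bernoulliSeries χ s / (s - 1)) fun n => ?_⟩
    · refine ⟨c, fun s hs => (hc' s hs).summable, fun s hs hs1 => ?_⟩
      rw [(hc' s hs).tsum_eq]
      exact mul_div_cancel₀ _ (sub_ne_zero.2 hs1)
    · refine (mul_div_cancel₀ _ ?_).symm
      rw [neg_one_sub_natCast, neg_ne_zero]
      exact_mod_cast n.succ_ne_zero
  · obtain ⟨d, q, hd, hq⟩ := hc'.exists_mul_sub_one hR hc (bernoulliSeries_one h1)
    refine ⟨q, fun _ => ⟨d, fun s hs => (hd s hs).summable, fun s hs _ => (hd s hs).tsum_eq.symm⟩,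
      fun h => absurd h h1, hint _ fun n => hq _ ?_⟩
    have : (1 : ℂ_[p]) - (n + 1 : ℕ) = -(n : ℕ) := by push_cast; ring
    rw [this, norm_neg]
    exact (IsUltrametricDist.norm_natCast_le_one _ _).trans_lt hR

theorem isPadicLFunction_padicL (hp : p ≠ 2) {χ : DirichletCharacter ℂ_[p] f}
    (hχ : PrimitiveAwayFrom χ) : IsPadicLFunction χ (padicL χ) :=
  Classical.epsilon_spec (exists_isPadicLFunction hp hχ)

/-- The interpolation property in terms of a period sum over the integers prime to `p`. -/
theorem padicL_neg_natCast (hp : p ≠ 2) {χ : DirichletCharacter ℂ_[p] f}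
    (hχ : PrimitiveAwayFrom χ) (n : ℕ) :
    padicL χ (-(n : ℂ_[p])) =
      -(bernoulliSum (f * p) (twistFun χ (n + 1)) (n + 1) / (n + 1)) := by
  have h := (isPadicLFunction_padicL hp hχ).interpolation (n + 1) (by omega)
  rw [Nat.add_sub_cancel] at h
  rw [bernoulliSum_twistFun hχ, show -(n : ℂ_[p]) = 1 - (n + 1 : ℕ) by push_cast; ring, h]
  push_cast
  ring

end Existence

/-! ### Alternating sums -/

section AlternatingSums

variable {p : ℕ} [Fact p.Prime] {f : ℕ}

/-- The alternating sum `½ ∑ (-1)^(a+1) χω⁻¹(a) (⟨a⟩ - 1)ʲ` over `a ≤ f pⁿ`. -/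
noncomputable def altMoment (χ : DirichletCharacter ℂ_[p] f) (j n : ℕ) : ℂ_[p] :=
  1 / 2 * ∑ a ∈ Finset.Icc 1 (f * p ^ n),
    (-1) ^ (a + 1) * (twistFun χ 1 a * (angle a - 1) ^ j)

theorem norm_one_half (hp : p ≠ 2) : ‖(1 / 2 : ℂ_[p])‖ = 1 := by
  rw [norm_div, norm_one, norm_natCast_two hp, div_one]

theorem norm_twistFun_one_mul_le (χ : DirichletCharacter ℂ_[p] f) (j a : ℕ) :
    ‖twistFun χ 1 a * (angle a - 1) ^ j‖ ≤ 1 / (p : ℝ) ^ j := by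
  by_cases ha : p ∣ a
  · rw [twistFun_eq_zero χ one_ne_zero ha, zero_mul, norm_zero]
    positivity
  · rw [norm_mul]
    exact (mul_le_of_le_one_left (norm_nonneg _) (norm_twistFun_le χ 1 a)).trans
      (norm_ppow_coeff_le (norm_angle_sub_one_le ha) j)

theorem norm_altMoment_le (hp : p ≠ 2) (χ : DirichletCharacter ℂ_[p] f) (j n : ℕ) :
    ‖altMoment χ j n‖ ≤ 1 / (p : ℝ) ^ j := by
  rw [altMoment, norm_mul, norm_one_half hp, one_mul]
  refine IsUltrametricDist.norm_sum_le_of_forall_le_of_nonneg (by positivity) fun a _ => ?_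
  rw [norm_mul, norm_pow, norm_neg, norm_one, one_pow, one_mul]
  exact norm_twistFun_one_mul_le χ j a

/-- The alternating sums are binomial series in `-s` whose coefficients are alternating moments. -/
theorem altSum_eq_tsum (hp : p ≠ 2) (χ : DirichletCharacter ℂ_[p] f) {s : ℂ_[p]}
    (hs : ‖s‖ < radius p) (n : ℕ) :
    altSum χ s n = ∑' j, Ring.choose (-s) j * altMoment χ j n := by
  have hs' : ‖-s‖ < radius p := by rwa [norm_neg]
  have hterm : ∀ a ∈ Finset.Icc 1 (f * p ^ n), Summable fun j =>
      Ring.choose (-s) j * (twistFun χ 1 a * (angle a - 1) ^ j) := fun a _ =>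
    summable_choose_mul hp hs' (fun j => norm_twistFun_one_mul_le χ j a)
  have h1 : ∀ j, Ring.choose (-s) j * altMoment χ j n =
      1 / 2 * ∑ a ∈ Finset.Icc 1 (f * p ^ n), (-1) ^ (a + 1) *
        (Ring.choose (-s) j * (twistFun χ 1 a * (angle a - 1) ^ j)) := fun j => by
    rw [altMoment, mul_left_comm, Finset.mul_sum]
    congr 1
    exact Finset.sum_congr rfl fun a _ => by ring
  simp only [h1]
  rw [tsum_mul_left, Summable.tsum_finsetSum fun a ha => (hterm a ha).mul_left _, altSum,
    Finset.sum_filter]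
  congr 1
  refine Finset.sum_congr rfl fun a _ => ?_
  rw [tsum_mul_left]
  split_ifs with ha
  · simp only [twistFun_eq_zero χ one_ne_zero ha, zero_mul, mul_zero, tsum_zero]
  · rw [one_div_ppow hp (norm_angle_sub_one_le ha) hs, ppow, mul_assoc, twistFun, pow_one,
      ← tsum_mul_left]
    congr 1
    exact tsum_congr fun j => by ring

theorem altSum_neg_natCast (χ : DirichletCharacter ℂ_[p] f) (hp : p ≠ 2) (l n : ℕ) :
    altSum χ (-(l : ℂ_[p])) n = 1 / 2 * ∑ a ∈ Finset.Icc 1 (f * p ^ n),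
      (-1) ^ (a + 1) * (twistFun χ (l + 1) a * (a : ℂ_[p]) ^ l) := by
  have hl : ‖-(l : ℂ_[p])‖ < radius p := by
    rw [norm_neg]
    exact (IsUltrametricDist.norm_natCast_le_one _ _).trans_lt (one_lt_radius hp)
  rw [altSum, Finset.sum_filter]
  congr 1
  refine Finset.sum_congr rfl fun a _ => ?_
  rw [twistFun_succ_mul_pow]
  split_ifs with ha
  · rw [twistFun_eq_zero χ one_ne_zero ha, zero_mul, mul_zero]
  · rw [one_div_ppow hp (norm_angle_sub_one_le ha) hl, neg_neg, ppow_natCast, twistFun, pow_one,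
      mul_assoc]

/-- The value at `s` of the function `1 - χ(2) ⟨2⟩^(1-s)`. -/
noncomputable def eulerFactorTwo (χ : DirichletCharacter ℂ_[p] f) (s : ℂ_[p]) : ℂ_[p] :=
  1 - χ (2 : ZMod f) * ppow (angle 2) (1 - s)

theorem eulerFactorTwo_neg_natCast (χ : DirichletCharacter ℂ_[p] f) (l : ℕ) :
    eulerFactorTwo χ (-(l : ℂ_[p])) = 1 - twistFun χ (l + 1) 2 * 2 ^ (l + 1) := by
  have h := twistFun_mul_pow χ (l + 1) 2
  rw [Nat.cast_ofNat, Nat.cast_ofNat] at h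
  rw [h, eulerFactorTwo, ← ppow_natCast, sub_neg_eq_add, Nat.cast_add, Nat.cast_one, add_comm]

theorem not_dvd_two (hp : p ≠ 2) : ¬ p ∣ 2 := fun h =>
  hp ((Nat.prime_dvd_prime_iff_eq Fact.out Nat.prime_two).1 h)

theorem exists_isPowerSeriesOn_eulerFactorTwo (hp : p ≠ 2) (χ : DirichletCharacter ℂ_[p] f) :
    ∃ c : ℕ → ℂ_[p], IsPowerSeriesOn (radius p) c (eulerFactorTwo χ) := by
  obtain ⟨c, _, hc⟩ := exists_isPowerSeriesOn_ppow_one_sub hp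
    (norm_angle_sub_one_le (not_dvd_two hp))
  exact ⟨_, (isPowerSeriesOn_const _ 1).sub (hc.const_mul (χ (2 : ZMod f)))⟩

variable [NeZero f] {χ : DirichletCharacter ℂ_[p] f}

/-- The interpolation property of the limit of the alternating sums. -/
theorem tendsto_altSum_neg_natCast (hp : p ≠ 2) (hχ : PrimitiveAwayFrom χ) (hf : Odd f) (l : ℕ) :
    Tendsto (altSum χ (-(l : ℂ_[p]))) atTop
      (𝓝 (eulerFactorTwo χ (-(l : ℂ_[p])) * padicL χ (-(l : ℂ_[p])))) := by
  have hpo : Odd p := (Fact.out : p.Prime).odd_of_ne_two hp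
  -- The period of `twistFun` is `f p`, so `altSum χ s (m + 1)` runs up to `f p * p ^ m`.
  have h := tendsto_alternating_sum hp (hf.mul hpo) (twistFun_add χ (l + 1))
    (fun a => twistFun_mul χ (l + 1) 2 a) l
  rw [← tendsto_add_atTop_iff_nat 1, eulerFactorTwo_neg_natCast, padicL_neg_natCast hp hχ, mul_neg,
    ← mul_div_assoc]
  refine h.congr fun m => ?_
  rw [altSum_neg_natCast χ hp, pow_succ', ← mul_assoc]

/-- The moments converge, being finite combinations of alternating sums at negative integers. -/
theorem exists_tendsto_altMoment (hp : p ≠ 2) (hχ : PrimitiveAwayFrom χ) (hf : Odd f) (j : ℕ) :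
    ∃ T : ℂ_[p], Tendsto (altMoment χ j) atTop (𝓝 T) := by
  have h : ∀ n, altMoment χ j n = ∑ l ∈ Finset.range (j + 1),
      ((-1) ^ (j - l) * (j.choose l : ℂ_[p])) * altSum χ (-(l : ℂ_[p])) n := by
    intro n
    simp only [altSum_neg_natCast χ hp, twistFun_succ_mul_pow, altMoment, Finset.mul_sum]
    rw [Finset.sum_comm]
    refine Finset.sum_congr rfl fun a _ => ?_
    rw [sub_eq_add_neg, add_pow, Finset.mul_sum, Finset.mul_sum, Finset.mul_sum]
    exact Finset.sum_congr rfl fun l _ => by ring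
  exact ⟨_, (tendsto_finsetSum _ fun l _ =>
    (tendsto_altSum_neg_natCast hp hχ hf l).const_mul _).congr fun n => (h n).symm⟩

/-- The alternating sums converge on the whole disc, to a bounded power series. -/
theorem exists_limit_altSum (hp : p ≠ 2) (hχ : PrimitiveAwayFrom χ) (hf : Odd f) :
    ∃ (g : ℂ_[p] → ℂ_[p]) (c : ℕ → ℂ_[p]), HasBoundedCoeffs (radius p) c ∧
      IsPowerSeriesOn (radius p) c g ∧
      ∀ s, ‖s‖ < radius p → Tendsto (altSum χ s) atTop (𝓝 (g s)) := by
  choose T hT using exists_tendsto_altMoment hp hχ hf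
  have hTb : ∀ j, ‖T j‖ ≤ 1 / (p : ℝ) ^ j := fun j =>
    le_of_tendsto (hT j).norm (Eventually.of_forall fun n => norm_altMoment_le hp χ j n)
  have hdeg : (-Polynomial.X : Polynomial ℤ).natDegree ≤ 1 := by compute_degree
  have hps := exists_isPowerSeriesOn_choose hp hdeg hTb
  simp only [map_neg, Polynomial.aeval_X] at hps
  obtain ⟨c, hc, hc'⟩ := hps
  refine ⟨_, c, hc, hc', fun s hs => ?_⟩
  have hs' : ‖-s‖ < radius p := by rwa [norm_neg]
  rw [show altSum χ s = fun n => ∑' j, Ring.choose (-s) j * altMoment χ j n from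
    funext fun n => altSum_eq_tsum hp χ hs n]
  exact tendsto_tsum_of_dominated_convergence (summable_geometric_max hp hs' 1)
    (fun j => (hT j).const_mul _) (Eventually.of_forall fun n j =>
      norm_choose_mul_le (le_max_left _ _) (le_max_right _ _) (norm_altMoment_le hp χ j n))

/-- The integers `-pⁿ` accumulate at `0`. -/
theorem frequently_neg_natCast {P : ℂ_[p] → Prop} (h : ∀ l : ℕ, P (-(l : ℂ_[p]))) :
    ∃ᶠ s in 𝓝[≠] (0 : ℂ_[p]), P s := by
  have ht : Tendsto (fun n : ℕ => -((p ^ n : ℕ) : ℂ_[p])) atTop (𝓝[≠] 0) := by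
    refine tendsto_nhdsWithin_iff.2 ⟨by simpa using tendsto_prime_pow.neg, ?_⟩
    refine Eventually.of_forall fun n => ?_
    have : ((p ^ n : ℕ) : ℂ_[p]) ≠ 0 := by
      exact_mod_cast pow_ne_zero n (Fact.out : p.Prime).ne_zero
    simpa using this
  exact ht.frequently (Frequently.of_forall fun n => h (p ^ n))

/-- A power series that takes the values of `(1 - χ(2) ⟨2⟩^(1-s)) L_p(s, χ)` at the integers
`s ≤ 0` represents that function. -/
theorem eq_eulerFactorTwo_mul_padicL (hp : p ≠ 2) (hχ : PrimitiveAwayFrom χ) {g : ℂ_[p] → ℂ_[p]}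
    {c : ℕ → ℂ_[p]} (hg : IsPowerSeriesOn (radius p) c g)
    (hint : ∀ l : ℕ, g (-(l : ℂ_[p])) =
      eulerFactorTwo χ (-(l : ℂ_[p])) * padicL χ (-(l : ℂ_[p])))
    {s : ℂ_[p]} (hs : ‖s‖ < radius p) (hs1 : χ = 1 → s ≠ 1) :
    g s = eulerFactorTwo χ s * padicL χ s := by
  have hR := one_lt_radius hp
  have hL := isPadicLFunction_padicL hp hχ
  obtain ⟨e, he⟩ := exists_isPowerSeriesOn_eulerFactorTwo hp χ
  have hneg : ∀ l : ℕ, ‖-(l : ℂ_[p])‖ < radius p := fun l => by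
    rw [norm_neg]
    exact (IsUltrametricDist.norm_natCast_le_one _ _).trans_lt hR
  by_cases h1 : χ = 1
  · -- Here both sides are multiplied by `s - 1` to remove the possible pole.
    obtain ⟨d, hd, hd'⟩ := hL.meromorphic h1
    have hM : IsPowerSeriesOn (radius p) d fun s => ∑' n, d n * s ^ n := fun s hs =>
      (hd s hs).hasSum
    have hX : IsPowerSeriesOn (radius p) _ fun s : ℂ_[p] => s - 1 :=
      (isPowerSeriesOn_id _).sub (isPowerSeriesOn_const _ 1)
    have hl1 : ∀ l : ℕ, -(l : ℂ_[p]) ≠ 1 := fun l h => by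
      have h2 : ((l + 1 : ℕ) : ℂ_[p]) = 0 := by push_cast; linear_combination -h
      exact l.succ_ne_zero (by exact_mod_cast h2)
    have key := (hX.mul hg).eqOn_of_frequently_eq (one_pos.trans hR) (he.mul hM)
      (frequently_neg_natCast fun l => by
        rw [← hd' _ (hneg l) (hl1 l), hint l]; ring) hs
    rw [← hd' s hs (hs1 h1)] at key
    exact mul_left_cancel₀ (sub_ne_zero.2 (hs1 h1)) (by rw [key]; ring)
  · obtain ⟨d, hd, hd'⟩ := hL.analytic h1
    have hM : IsPowerSeriesOn (radius p) d (padicL χ) := fun s hs => by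
      rw [hd' s hs (Set.notMem_empty s)]
      exact (hd s hs).hasSum
    exact hg.eqOn_of_frequently_eq (one_pos.trans hR) (he.mul hM) (frequently_neg_natCast hint) hs

/-- The limit of the alternating sums is continuous on the disc and equals
`(1 - χ(2) ⟨2⟩^(1-s)) L_p(s, χ)` away from the pole. -/
theorem exists_altSum_expansion (hp : p ≠ 2) (hχ : PrimitiveAwayFrom χ) (hf : Odd f) :
    ∃ g : ℂ_[p] → ℂ_[p], (∀ s, ‖s‖ < radius p → ContinuousAt g s) ∧
      (∀ s, ‖s‖ < radius p → Tendsto (altSum χ s) atTop (𝓝 (g s))) ∧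
      ∀ s, ‖s‖ < radius p → (χ = 1 → s ≠ 1) → g s = eulerFactorTwo χ s * padicL χ s := by
  have hR := one_lt_radius hp
  obtain ⟨g, c, hc, hg, hlim⟩ := exists_limit_altSum hp hχ hf
  refine ⟨g, fun s hs => hg.continuousAt (one_pos.trans hR) hc hs, hlim,
    fun s hs hs1 => eq_eulerFactorTwo_mul_padicL hp hχ hg (fun l => ?_) hs hs1⟩
  refine tendsto_nhds_unique (hlim _ ?_) (tendsto_altSum_neg_natCast hp hχ hf l)
  rw [norm_neg]
  exact (IsUltrametricDist.norm_natCast_le_one _ _).trans_lt hR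

end AlternatingSums

/-! ### Nonvanishing of the Euler factor at `2` -/

section Nonvanishing

variable {p : ℕ} [Fact p.Prime]

theorem norm_choose_succ_le {u : ℂ_[p]} {M : ℝ} (hM : 1 ≤ M) (hu : ‖u‖ ≤ M) (j : ℕ) :
    ‖Ring.choose u (j + 1)‖ ≤ ‖u‖ * (M * factRate p) ^ j := by
  have hdeg : ((descPochhammer ℤ j).comp (Polynomial.X - 1)).natDegree ≤ j := by
    refine Polynomial.natDegree_comp_le.trans ?_
    rw [descPochhammer_natDegree]
    exact (Nat.mul_le_mul_left j (by compute_degree)).trans (Nat.mul_one j).le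
  rw [choose_eq_inv_factorial_mul_aeval, descPochhammer_succ_left, map_mul, Polynomial.aeval_X,
    norm_mul, norm_mul, mul_left_comm, mul_pow, mul_comm (M ^ j)]
  refine mul_le_mul_of_nonneg_left ?_ (norm_nonneg _)
  exact mul_le_mul (by simpa using norm_inv_factorial_le (p := p) j.succ_ne_zero)
    (norm_aeval_le hM hu hdeg) (norm_nonneg _) (pow_nonneg (one_pos.trans one_lt_factRate).le _)

/-- The terms of `x ^ u - 1` are dominated by the first one, `u (x - 1)`. -/
theorem norm_ppow_term_le {x u : ℂ_[p]} (hx : ‖x - 1‖ ≤ (p : ℝ)⁻¹) (j : ℕ) :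
    ‖Ring.choose u (j + 1) * (x - 1) ^ (j + 1)‖ ≤
      ‖u * (x - 1)‖ * (max 1 ‖u‖ / radius p) ^ j := by
  have h0 : (0 : ℝ) < factRate p := one_pos.trans one_lt_factRate
  rw [norm_mul, norm_pow, norm_mul, pow_succ]
  calc _ ≤ (‖u‖ * (max 1 ‖u‖ * factRate p) ^ j) * (((p : ℝ)⁻¹) ^ j * ‖x - 1‖) := by
        refine mul_le_mul (norm_choose_succ_le (le_max_left _ _) (le_max_right _ _) j) ?_
          (by positivity) (by positivity)
        exact mul_le_mul_of_nonneg_right (pow_le_pow_left₀ (norm_nonneg _) hx j) (norm_nonneg _)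
    _ = ‖u‖ * ‖x - 1‖ * (max 1 ‖u‖ / radius p) ^ j := by
        rw [← mul_factRate_div, div_eq_mul_inv, mul_pow _ ((p : ℝ)⁻¹)]; ring

variable {x u : ℂ_[p]}

theorem ppow_eq_one_add (hp : p ≠ 2) (hx : ‖x - 1‖ ≤ (p : ℝ)⁻¹) (hu : ‖u‖ < radius p) :
    ppow x u = 1 + ∑' j, Ring.choose u (j + 1) * (x - 1) ^ (j + 1) := by
  rw [ppow, (summable_choose_mul hp hu (norm_ppow_coeff_le hx)).tsum_eq_zero_add]
  simp

theorem norm_ppow_sub_one_lt (hp : p ≠ 2) (hx : ‖x - 1‖ ≤ (p : ℝ)⁻¹) (hu : ‖u‖ < radius p) :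
    ‖ppow x u - 1‖ < 1 := by
  have hR := one_lt_radius hp
  have hR0 := one_pos.trans hR
  have hp0 : (0 : ℝ) < p := one_pos.trans one_lt_prime
  rw [ppow_eq_one_add hp hx hu, add_sub_cancel_left]
  have h1 : ‖u * (x - 1)‖ < 1 := by
    rw [norm_mul]
    calc ‖u‖ * ‖x - 1‖ ≤ ‖u‖ * (p : ℝ)⁻¹ := mul_le_mul_of_nonneg_left hx (norm_nonneg _)
      _ < radius p * (p : ℝ)⁻¹ := mul_lt_mul_of_pos_right hu (by positivity)
      _ = (factRate p)⁻¹ := by rw [radius_eq]; field_simp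
      _ < 1 := inv_lt_one_of_one_lt₀ one_lt_factRate
  refine lt_of_le_of_lt
    (IsUltrametricDist.norm_tsum_le_of_forall_le_of_nonneg (norm_nonneg _) fun j => ?_) h1
  refine (norm_ppow_term_le hx j).trans (mul_le_of_le_one_right (norm_nonneg _) ?_)
  exact pow_le_one₀ (by positivity) ((div_le_one hR0).2 (max_lt hR hu).le)

theorem ppow_ne_one (hp : p ≠ 2) (hx : ‖x - 1‖ ≤ (p : ℝ)⁻¹) (hu : ‖u‖ < radius p) (hx1 : x ≠ 1)
    (hu0 : u ≠ 0) : ppow x u ≠ 1 := by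
  intro h
  have hR := one_lt_radius hp
  have hR0 := one_pos.trans hR
  have hs := (summable_nat_add_iff 1).2 (summable_choose_mul hp hu (norm_ppow_coeff_le hx))
  have h0 := ppow_eq_one_add hp hx hu
  rw [h, left_eq_add, hs.tsum_eq_zero_add, zero_add, Ring.choose_one_right, pow_one] at h0
  have hpos : 0 < ‖u * (x - 1)‖ := norm_pos_iff.2 (mul_ne_zero hu0 (sub_ne_zero.2 hx1))
  have hr1 : max 1 ‖u‖ / radius p < 1 := (div_lt_one hR0).2 (max_lt hR hu)
  -- If the sum vanishes, its first term equals minus the sum of the strictly smaller others.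
  have hle : ‖u * (x - 1)‖ ≤ ‖u * (x - 1)‖ * (max 1 ‖u‖ / radius p) := by
    nth_rewrite 1 [eq_neg_of_add_eq_zero_left h0]
    rw [norm_neg]
    refine IsUltrametricDist.norm_tsum_le_of_forall_le_of_nonneg (by positivity) fun j => ?_
    refine (norm_ppow_term_le hx (j + 1)).trans (mul_le_mul_of_nonneg_left ?_ (norm_nonneg _))
    exact pow_le_of_le_one (by positivity) hr1.le j.succ_ne_zero
  exact absurd hle (not_le.2 (mul_lt_of_lt_one_right hpos hr1))

/-- If `⟨2⟩ = 1`, then `2 = ω(2)`, contradicting `2 ^ (p - 1) ≠ 1`. -/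
theorem angle_two_ne_one (hp : p ≠ 2) : (angle 2 : ℂ_[p]) ≠ 1 := by
  have hpp : p.Prime := Fact.out
  have h2 : (((2 : ℕ) : ZMod p)) ≠ 0 := natCast_zmod_ne_zero (not_dvd_two hp)
  intro h
  rw [angle, inv_mul_eq_one₀ (teich_ne_zero h2)] at h
  have h3 := teich_pow_sub_one h2
  rw [h] at h3
  have h4 : 2 ^ (p - 1) = 1 := by exact_mod_cast h3
  exact (Nat.one_lt_two_pow (Nat.sub_pos_of_lt hpp.one_lt).ne').ne' h4

/-- The factor `1 - ω(b) ⟨2⟩^(1-s)` vanishes at most for `ω(b) = 1` and `s = 1`: if `ω(b) ≠ 1`, then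
`ω(b)` is not congruent to `1`, whereas `⟨2⟩^(1-s)` is. -/
theorem one_sub_teich_mul_ppow_ne_zero (hp : p ≠ 2) (b : ZMod p) {s : ℂ_[p]} (hs : ‖s‖ < radius p)
    (h : ¬ (s = 1 ∧ teich p b = 1)) :
    1 - teich p b * ppow (angle 2) (1 - s) ≠ 0 := by
  have hx := norm_angle_sub_one_le (not_dvd_two hp)
  have hu : ‖1 - s‖ < radius p := by
    rw [sub_eq_add_neg]
    refine (IsUltrametricDist.norm_add_le_max _ _).trans_lt (max_lt ?_ (by rwa [norm_neg]))
    rw [norm_one]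
    exact one_lt_radius hp
  by_cases hb : teich p b = 1
  · rw [hb, one_mul, sub_ne_zero]
    exact (ppow_ne_one hp hx hu (angle_two_ne_one hp)
      (sub_ne_zero.2 fun h1 => h ⟨h1.symm, hb⟩)).symm
  · intro h0
    have hb1 : b ≠ 1 := fun h1 => hb (by rw [h1, map_one])
    have h1 : teich p b - 1 = -(teich p b * (ppow (angle 2) (1 - s) - 1)) := by
      linear_combination -h0
    have h2 := norm_teich_sub_one hb1
    rw [h1, norm_neg, norm_mul] at h2
    refine absurd h2 (ne_of_lt ?_)
    exact (mul_le_of_le_one_left (norm_nonneg _) (DirichletCharacter.norm_le_one _ _)).trans_lt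
      (norm_ppow_sub_one_lt hp hx hu)

end Nonvanishing

end KW

theorem mainTheorem6 (p : ℕ) [Fact p.Prime] (hp : p ≠ 2) :
    -- the expansion for even primitive `χ` of odd conductor `f`
    (∀ (f : ℕ) [NeZero f] (χ : DirichletCharacter ℂ_[p] f),
      χ.IsPrimitive → χ.Even → Odd f →
        -- all `s` in the disc other than the pole `s = 1` of `L_p(s, 1)`
        (∀ s : ℂ_[p], ‖s‖ < KW.radius p → (χ = 1 → s ≠ 1) →
          Tendsto (fun n : ℕ => KW.altSum χ s n) atTop
            (𝓝 ((1 - χ (2 : ZMod f) * KW.ppow (KW.angle 2) (1 - s)) * KW.padicL χ s))) ∧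
        -- at the pole, with the left side extended continuously
        (χ = 1 → ∃ l : ℂ_[p],
          Tendsto (fun n : ℕ => KW.altSum χ 1 n) atTop (𝓝 l) ∧
          Tendsto (fun s : ℂ_[p] =>
            (1 - χ (2 : ZMod f) * KW.ppow (KW.angle 2) (1 - s)) * KW.padicL χ s)
            (𝓝[≠] 1) (𝓝 l))) ∧
    -- the branches of the `p`-adic zeta function
    (∀ i : ℕ, 1 ≤ i → i ≤ p - 2 → Odd i →
      ∀ s : ℂ_[p], ‖s‖ < KW.radius p →
        ¬ (s = 1 ∧ (KW.teich p (2 : ZMod p)) ^ (1 - (i : ℤ)) = 1) →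
        1 - (KW.teich p (2 : ZMod p)) ^ (1 - (i : ℤ)) * KW.ppow (KW.angle 2) (1 - s) ≠ 0 ∧
        ∃ l : ℂ_[p],
          Tendsto (fun n : ℕ => 1 / 2 *
            ∑ a ∈ (Finset.Icc 1 (p ^ n)).filter (fun a => ¬ p ∣ a),
              (-1) ^ (a + 1) * ((KW.teich p (a : ZMod p)) ^ i)⁻¹ * (1 / KW.ppow (KW.angle a) s))
            atTop (𝓝 l) ∧
          KW.padicZeta p i s =
            1 / (1 - (KW.teich p (2 : ZMod p)) ^ (1 - (i : ℤ)) *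
              KW.ppow (KW.angle 2) (1 - s)) * l) := by
  have hpp : p.Prime := Fact.out
  have hone : ‖(1 : ℂ_[p])‖ < KW.radius p := by
    rw [norm_one]
    exact KW.one_lt_radius hp
  refine ⟨fun f _ χ hprim _ hodd => ?_, fun i hi _ _ s hs hne => ?_⟩
  · have hχ : KW.PrimitiveAwayFrom χ := fun l _ hl _ => by rwa [hprim]
    obtain ⟨g, hcont, hlim, hg⟩ := KW.exists_altSum_expansion hp hχ hodd
    refine ⟨fun s hs hs1 => ?_, fun h1 => ⟨g 1, hlim 1 hone, ?_⟩⟩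
    · have h := hlim s hs
      rwa [hg s hs hs1] at h
    · refine ((hcont 1 hone).tendsto.mono_left nhdsWithin_le_nhds).congr' ?_
      have hball : ∀ᶠ s in 𝓝 (1 : ℂ_[p]), ‖s‖ < KW.radius p :=
        continuous_norm.continuousAt.eventually_lt continuousAt_const hone
      filter_upwards [hball.filter_mono nhdsWithin_le_nhds, self_mem_nhdsWithin] with s hs hs1
      exact hg s hs fun _ => hs1
  · have : NeZero p := ⟨hpp.ne_zero⟩
    have hi0 : i ≠ 0 := by omega
    have h2 : ((2 : ℕ) : ZMod p) ≠ 0 := KW.natCast_zmod_ne_zero (KW.not_dvd_two hp)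
    rw [Nat.cast_ofNat] at h2
    obtain ⟨χ, hχdef⟩ : ∃ χ : DirichletCharacter ℂ_[p] p, χ = KW.teich p ^ (1 - (i : ℤ)) :=
      ⟨_, rfl⟩
    have hval : ∀ a : ZMod p, χ a = KW.teich p a * (KW.teich p a ^ i)⁻¹ := fun a => by
      rw [hχdef, zpow_sub, zpow_one, zpow_natCast, MulChar.mul_apply, MulChar.inv_apply_eq_inv',
        MulChar.pow_apply' _ hi0]
    have hval2 : KW.teich p (2 : ZMod p) ^ (1 - (i : ℤ)) = χ 2 := by
      rw [hval, zpow_sub₀ (KW.teich_ne_zero h2), zpow_one, zpow_natCast, div_eq_mul_inv]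
    have hteich : χ 2 = KW.teich p ((2 : ZMod p) * ((2 : ZMod p) ^ i)⁻¹) := by
      rw [hval, map_mul, ← map_pow]
      congr 1
      refine inv_eq_of_mul_eq_one_right ?_
      rw [← map_mul, mul_inv_cancel₀ (pow_ne_zero i h2), map_one]
    rw [hval2] at hne ⊢
    have hE : 1 - χ 2 * KW.ppow (KW.angle 2) (1 - s) ≠ 0 := by
      rw [hteich] at hne ⊢
      exact KW.one_sub_teich_mul_ppow_ne_zero hp _ hs hne
    have hχ : KW.PrimitiveAwayFrom χ := fun l hl hlp hne' =>
      absurd ((Nat.prime_dvd_prime_iff_eq hl hpp).1 hlp) hne'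
    obtain ⟨g, -, hlim, hg⟩ := KW.exists_altSum_expansion hp hχ (hpp.odd_of_ne_two hp)
    refine ⟨hE, g s, ?_, ?_⟩
    · -- The modulus of `χ` is `p`, so `altSum χ s n` runs up to `p * p ^ n`.
      rw [← tendsto_add_atTop_iff_nat 1]
      refine (hlim s hs).congr fun n => ?_
      rw [KW.altSum, pow_succ']
      congr 1
      refine Finset.sum_congr rfl fun a ha => ?_
      have ha0 := KW.teich_ne_zero (KW.natCast_zmod_ne_zero (Finset.mem_filter.1 ha).2)
      rw [hval, mul_right_comm (KW.teich p _), mul_inv_cancel₀ ha0, one_mul]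
    · have hs1 : χ = 1 → s ≠ 1 := fun h1 hs1 => by
        refine hne ⟨hs1, ?_⟩
        rw [h1, MulChar.one_apply (isUnit_iff_ne_zero.2 h2)]
      rw [hg s hs hs1, KW.padicZeta, ← hχdef, one_div, KW.eulerFactorTwo, inv_mul_cancel_left₀ hE]
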